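/- Let $n\ge 1$, let $\mathbb{CH}^n$ be complex hyperbolic space with its metric $\mathfrak c_n$ of constant holomorphic sectional curvature $-4$ and complex structure $J$, and let $\mathbb{CH}^{n-1}\subset\mathbb{CH}^n$ be a totally geodesic complex hyperplane. Let $\phi:\mathbb{CH}^n\to\mathbb{CH}^{n-1}$ be the orthogonal projection, $r$ the distance to $\mathbb{CH}^{n-1}$, $u=\cosh r$, and let $\mathcal H$ be the horizontal distribution, i.e. the $\mathfrak c_n$-orthogonal complement of $\ker d\phi$. On the fibres of $\phi$ minus $\mathbb{CH}^{n-1}$ let $\partial/\partial\theta$ be the generator of the $2\pi$-periodic rotation about $\mathbb{CH}^{n-1}$, oriented so that $J\,\partial/\partial\theta$ is a positive multiple of $\partial/\partial u$, where $\partial/\partial u$ is radial in the fibre with $du(\partial/\partial u)=1$. Let $d\theta$ be the one-form vanishing on $\mathcal H$ and on $\partial/\partial u$ with $d\theta(\partial/\partial\theta)=1$. Let $W$ be a smooth positive function on an open set $I$ of real numbers, and on the part of $\mathbb{CH}^n\setminus\mathbb{CH}^{n-1}$ where $u\in I$ consider the metric $$\lambda=u^2\,\phi^*\mathfrak c_{n-1}+u^2W(u)^2\,d\theta^2+\frac{1}{W(u)^2}\,du^2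 .$$ At a point $q$ of this region let $X_1,\dots,X_{2n-2}\in\mathcal H_q$ be a holomorphic frame: the vectors $d\phi(X_i)$ form a $\mathfrak c_{n-1}$-orthonormal basis of $T_{\phi(q)}\mathbb{CH}^{n-1}$ and $d\phi(X_{i+1})=J\,d\phi(X_i)$ for $i$ odd. Put $$Y_i=\tfrac1u X_i\ (1\le i\le 2n-2),\qquad Y_{2n-1}=\frac{1}{uW}\frac{\partial}{\partial\theta},\qquad Y_{2n}=W\frac{\partial}{\partial u},$$ and $R_{a,b,c,d}=\lambda(R(Y_a,Y_b)Y_c,Y_d)$, where $R(A,B)C=\nabla_B\nabla_AC-\nabla_A\nabla_BC+\nabla_{[A,B]}C$ and $\nabla$ is the Levi-Civita connection of $\lambda$ (so $R_{a,b,a,b}$ is a sectional curvature for $a\ne b$). Call $(Y_i,Y_j)$ with $1\le i,j\le 2n-2$ a holomorphic pair if $\{i,j\}=\{k,k+1\}$ with $k$ odd. Then $(Y_a)_{a=1}^{2n}$ is $\lambda$-orthonormal, $R$ has the symmetries $R_{b,a,c,d}=-R_{a,b,c,d}$, $R_{a,b,d,c}=-R_{a,b,c,d}$, $R_{c,d,a,b}=R_{a,b,c,d}$,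 and with $W,W',W''$ evaluated at $u=u(q)$ and $1\le i,j\le 2n-2$: 1. $R_{i,i+1,i,i+1}=-4\,\dfrac{1+W^2}{u^2}$ for $i$ odd. 2. $R_{i,j,i,j}=-\dfrac{1+W^2}{u^2}$ for $i\neq j$ with $(Y_i,Y_j)$ not a holomorphic pair. 3. $R_{i,2n-1,i,2n-1}=R_{i,2n,i,2n}=-\dfrac{WW'}{u}$. 4. $R_{2n-1,2n,2n-1,2n}=-3\,\dfrac{WW'}{u}-\left(WW''+(W')^2\right)$. 5. $R_{i,i+1,j,j+1}=2R_{i,j,i+1,j+1}=-2R_{i,j+1,i+1,j}=-2\,\dfrac{1+W^2}{u^2}$ for $i\ne j$ both odd. 6. $R_{i,i+1,2n-1,2n}=2R_{i,2n-1,i+1,2n}=-2R_{i,2n,i+1,2n-1}=-2\,\dfrac{WW'}{u}$ for $i$ odd. Every component $R_{a,b,c,d}$, $1\le a,b,c,d\le 2n$, that is not obtained from one of those listed in 1–6 by the symmetries above is zero. -/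

import Mathlib

open scoped ContDiff

noncomputable section

namespace CHWarp

/-! ### Riemannian geometry on open subsets of a real vector space

A (pseudo-)Riemannian metric on an open subset of `E` is given by the bilinear forms `g x` on the
tangent space `T_x = E`. -/

section Riemannian

variable {E : Type*} [NormedAddCommGroup E] [NormedSpace ℝ E]

/-- The Levi-Civita connection of `g` on constant vector fields: `∇_v w = Γ_x(v, w)` is the vector
with `g_x(Γ_x(v, w), z) = (1/2) (D_v g(w, z) + D_w g(v, z) - D_z g(v, w))` for all `z`
(the Koszul formula). -/
def christoffel (g : E → E →L[ℝ] E →L[ℝ] ℝ) (x v w : E) : E :=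
  (g x).inverse ((1 / 2 : ℝ) •
    (fderiv ℝ g x v w + fderiv ℝ g x w v - ((fderiv ℝ g x).flip v).flip w))

/-- The Levi-Civita covariant derivative `∇_X Y` of vector fields. -/
def covDeriv (g : E → E →L[ℝ] E →L[ℝ] ℝ) (X Y : E → E) (x : E) : E :=
  fderiv ℝ Y x (X x) + christoffel g x (X x) (Y x)

/-- The curvature `R(X, Y)Z = ∇_Y ∇_X Z - ∇_X ∇_Y Z + ∇_{[X, Y]} Z` of vector fields. -/
def curvatureField (g : E → E →L[ℝ] E →L[ℝ] ℝ) (X Y Z : E → E) (x : E) : E :=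
  covDeriv g Y (covDeriv g X Z) x - covDeriv g X (covDeriv g Y Z) x
    + covDeriv g (VectorField.lieBracket ℝ X Y) Z x

/-- The Riemann curvature tensor `g(R(a, b)c, d)` at the point `x`, evaluated on tangent vectors
(extended to constant vector fields; the curvature being a tensor, the extension is irrelevant).
With this sign `riemann g x a b a b` is the sectional curvature when `a, b` are orthonormal. -/
def riemann (g : E → E →L[ℝ] E →L[ℝ] ℝ) (x a b c d : E) : ℝ :=
  g x (curvatureField g (fun _ => a) (fun _ => b) (fun _ => c) x) d

end Riemannian

/-! ### Complex hyperbolic space -/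

/-- `ℂ^k` with its standard Hermitian inner product. -/
abbrev Cvec (k : ℕ) := EuclideanSpace ℂ (Fin k)

/-- The real linear form `v ↦ Re ⟪z, v⟫`. -/
def reForm {k : ℕ} (z : Cvec k) : Cvec k →L[ℝ] ℝ :=
  Complex.reCLM.comp ((innerSL ℂ z).restrictScalars ℝ)

/-- The real linear form `v ↦ Im ⟪z, v⟫`. -/
def imForm {k : ℕ} (z : Cvec k) : Cvec k →L[ℝ] ℝ :=
  Complex.imCLM.comp ((innerSL ℂ z).restrictScalars ℝ)

/-- The complex hyperbolic metric `𝔠_k` in the ball model `{z ∈ ℂ^k | ‖z‖ < 1}` of `ℂℍ^k`,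
normalized to constant holomorphic sectional curvature `-4`:
`Re ⟪v, w⟫ / (1 - ‖z‖²) + Re (conj ⟪z, v⟫ * ⟪z, w⟫) / (1 - ‖z‖²)²`. -/
def chMetric (k : ℕ) (z : Cvec k) : Cvec k →L[ℝ] Cvec k →L[ℝ] ℝ :=
  (1 - ‖z‖ ^ 2)⁻¹ • (isBoundedBilinearMap_inner (𝕜 := ℝ) (E := Cvec k)).toContinuousLinearMap
    + ((1 - ‖z‖ ^ 2)⁻¹) ^ 2 •
      ((reForm z).smulRight (reForm z) + (imForm z).smulRight (imForm z))

theorem chMetric_apply (k : ℕ) (z v w : Cvec k) :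
    chMetric k z v w = (1 - ‖z‖ ^ 2)⁻¹ * (inner ℂ v w).re
      + ((1 - ‖z‖ ^ 2)⁻¹) ^ 2 * (starRingEnd ℂ (inner ℂ z v) * inner ℂ z w).re := by
  have : inner ℝ v w = (inner ℂ v w).re := by
    simp [PiLp.inner_apply]
  have h2 : (starRingEnd ℂ (inner ℂ z v) * inner ℂ z w).re
      = (inner ℂ z v).re * (inner ℂ z w).re + (inner ℂ z v).im * (inner ℂ z w).im := by
    rw [Complex.mul_re, Complex.conj_re, Complex.conj_im]; ring
  rw [h2]
  simp [chMetric, reForm, imForm, this, mul_add]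

/-- The hyperbolic cosine of the `𝔠_k`-distance of two points of the ball model. -/
def coshDist {k : ℕ} (z w : Cvec k) : ℝ :=
  ‖1 - inner ℂ z w‖ / √((1 - ‖z‖ ^ 2) * (1 - ‖w‖ ^ 2))

/-! ### Polar coordinates about `ℂℍ^m = {z ∈ ℂℍ^(m+1) | z_(m+1) = 0}` -/

/-- `ℂℍ^(m+1) ∖ ℂℍ^m` in the ball model. -/
def punctured (m : ℕ) : Set (Cvec (m + 1)) :=
  {z | ‖z‖ < 1 ∧ z (Fin.last m) ≠ 0}

/-- The projection `(z_1, …, z_(m+1)) ↦ (z_1, …, z_m)`. On the ball it is the orthogonal projection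
`φ : ℂℍ^(m+1) → ℂℍ^m`; being linear, it is its own differential. -/
def proj (m : ℕ) : Cvec (m + 1) →L[ℝ] Cvec m :=
  LinearMap.toContinuousLinearMap
    { toFun := fun z => WithLp.toLp 2 (fun k : Fin m => z k.castSucc)
      map_add' := fun _ _ => rfl
      map_smul' := fun _ _ => rfl }

/-- The inclusion of `ℂℍ^m` as the totally geodesic hypersurface `z_(m+1) = 0`. -/
def incl (m : ℕ) (w : Cvec m) : Cvec (m + 1) :=
  WithLp.toLp 2 (Fin.snoc (α := fun _ => ℂ) (fun k => w k) 0)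

/-- The last coordinate `z ↦ z_(m+1)` as a real linear map. -/
def lastCoord (m : ℕ) : Cvec (m + 1) →L[ℝ] ℂ :=
  LinearMap.toContinuousLinearMap
    { toFun := fun z => z (Fin.last m)
      map_add' := fun _ _ => rfl
      map_smul' := fun _ _ => rfl }

/-- The coordinate `u = cosh r`, where `r` is the distance to `ℂℍ^m` (see `isLeast_radial`). -/
def radial (m : ℕ) (z : Cvec (m + 1)) : ℝ :=
  √((1 - ‖proj m z‖ ^ 2) / (1 - ‖z‖ ^ 2))

/-- The horizontal distribution: the `𝔠_(m+1)`-orthogonal complement of the tangent space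
`ker dφ` of the fibre of `φ`. -/
def IsHorizontal (m : ℕ) (z v : Cvec (m + 1)) : Prop :=
  ∀ w : Cvec (m + 1), proj m w = 0 → chMetric (m + 1) z v w = 0

/-- The angular vector field `∂/∂θ`, the generator of the rotation `z_(m+1) ↦ e^(-iθ) z_(m+1)`
of the fibres of `φ`. The angle is oriented so that `[X_i, X_(i+1)] = 2 ∂/∂θ` for the horizontal
lifts of a holomorphic pair, equivalently so that `J ∂/∂θ` is a positive multiple of `∂/∂u`. -/
def ddTheta (m : ℕ) (z : Cvec (m + 1)) : Cvec (m + 1) :=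
  EuclideanSpace.single (Fin.last m) (-Complex.I * z (Fin.last m))

/-- The radial field of the fibres of `φ`, before normalization. -/
def euler (m : ℕ) (z : Cvec (m + 1)) : Cvec (m + 1) :=
  EuclideanSpace.single (Fin.last m) (z (Fin.last m))

/-- The one-form `du`. -/
def du (m : ℕ) (z : Cvec (m + 1)) : Cvec (m + 1) →L[ℝ] ℝ :=
  fderiv ℝ (radial m) z

/-- The vector field `∂/∂u`: tangent to the fibres of `φ`, radial, and with `du(∂/∂u) = 1`. -/
def ddU (m : ℕ) (z : Cvec (m + 1)) : Cvec (m + 1) :=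
  (du m z (euler m z))⁻¹ • euler m z

/-- The one-form `dθ` of the polar coordinates: it vanishes on the horizontal distribution and on
`∂/∂u`, and `dθ(∂/∂θ) = 1` (see `dTheta_horizontal`, `dTheta_ddU`, `dTheta_ddTheta`). -/
def dTheta (m : ℕ) (z : Cvec (m + 1)) : Cvec (m + 1) →L[ℝ] ℝ :=
  -(Complex.imCLM.comp (ContinuousLinearMap.comp
      ((ContinuousLinearMap.mul ℝ ℂ) (z (Fin.last m))⁻¹) (lastCoord m)))
    - (1 - ‖proj m z‖ ^ 2)⁻¹ • (imForm (proj m z)).comp (proj m)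

/-- The warped metric
`λ = u² 𝔠_m + u² W(u)² dθ² + W(u)⁻² du²` on `ℂℍ^(m+1) ∖ ℂℍ^m`. -/
def warped (m : ℕ) (W : ℝ → ℝ) (z : Cvec (m + 1)) :
    Cvec (m + 1) →L[ℝ] Cvec (m + 1) →L[ℝ] ℝ :=
  radial m z ^ 2 • (chMetric m (proj m z)).bilinearComp (proj m) (proj m)
    + (radial m z ^ 2 * W (radial m z) ^ 2) • (dTheta m z).smulRight (dTheta m z)
    + (W (radial m z) ^ 2)⁻¹ • (du m z).smulRight (du m z)

@[simp] theorem proj_apply (m : ℕ) (z : Cvec (m + 1)) (k : Fin m) :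
    proj m z k = z k.castSucc := rfl

@[simp] theorem lastCoord_apply (m : ℕ) (z : Cvec (m + 1)) :
    lastCoord m z = z (Fin.last m) := rfl

theorem inner_eq (m : ℕ) (z w : Cvec (m + 1)) :
    inner ℂ z w = inner ℂ (proj m z) (proj m w)
      + starRingEnd ℂ (z (Fin.last m)) * w (Fin.last m) := by
  simp [PiLp.inner_apply, Fin.sum_univ_castSucc, mul_comm]

theorem normSq_eq (m : ℕ) (z : Cvec (m + 1)) :
    ‖z‖ ^ 2 = ‖proj m z‖ ^ 2 + Complex.normSq (z (Fin.last m)) := by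
  simp [EuclideanSpace.norm_sq_eq, Fin.sum_univ_castSucc, Complex.normSq_eq_norm_sq]

theorem punctured_pos (m : ℕ) (z : Cvec (m + 1)) (hz : ‖z‖ < 1) :
    0 < 1 - ‖z‖ ^ 2 ∧ 1 - ‖z‖ ^ 2 = 1 - ‖proj m z‖ ^ 2 - Complex.normSq (z (Fin.last m))
      ∧ 0 < 1 - ‖proj m z‖ ^ 2 := by
  have h1 : 0 < 1 - ‖z‖ ^ 2 := by nlinarith [norm_nonneg z]
  have h2 := normSq_eq m z
  have h3 := Complex.normSq_nonneg (z (Fin.last m))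
  exact ⟨h1, by linarith, by linarith⟩

theorem proj_incl (m : ℕ) (w : Cvec m) : proj m (incl m w) = w := by
  ext k; simp [incl]

theorem norm_incl (m : ℕ) (w : Cvec m) : ‖incl m w‖ ^ 2 = ‖w‖ ^ 2 := by
  rw [normSq_eq, proj_incl]; simp [incl]

theorem inner_incl (m : ℕ) (z : Cvec (m + 1)) (w : Cvec m) :
    inner ℂ z (incl m w) = inner ℂ (proj m z) w := by
  rw [inner_eq, proj_incl]; simp [incl]

theorem isLeast_radial (m : ℕ) (z : Cvec (m + 1)) (hz : ‖z‖ < 1) :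
    IsLeast {t | ∃ w : Cvec m, ‖w‖ < 1 ∧ t = coshDist z (incl m w)} (radial m z) := by
  obtain ⟨h1, h2, h3⟩ := punctured_pos m z hz
  have key : ∀ w : Cvec m, coshDist z (incl m w)
      = √(‖1 - inner ℂ (proj m z) w‖ ^ 2 / ((1 - ‖z‖ ^ 2) * (1 - ‖w‖ ^ 2))) := by
    intro w
    rw [coshDist, norm_incl, inner_incl, Real.sqrt_div (by positivity),
      Real.sqrt_sq (norm_nonneg _)]
  constructor
  · refine ⟨proj m z, by nlinarith [norm_nonneg (proj m z)], ?_⟩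
    rw [key, radial]
    congr 1
    have : (1 : ℂ) - inner ℂ (proj m z) (proj m z) = ((1 - ‖proj m z‖ ^ 2 : ℝ) : ℂ) := by
      rw [inner_self_eq_norm_sq_to_K]; push_cast; rfl
    rw [this, Complex.norm_real, Real.norm_eq_abs, sq_abs]
    field_simp
  · rintro t ⟨w, hw, rfl⟩
    rw [key, radial]
    apply Real.sqrt_le_sqrt
    have h4 : 0 < 1 - ‖w‖ ^ 2 := by nlinarith [norm_nonneg w]
    rw [div_le_div_iff₀ h1 (by positivity)]
    have h5 : 1 - ‖proj m z‖ * ‖w‖ ≤ ‖1 - inner ℂ (proj m z) w‖ := by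
      have a := norm_sub_norm_le (1 : ℂ) (inner ℂ (proj m z) w)
      have b := norm_inner_le_norm (𝕜 := ℂ) (proj m z) w
      rw [norm_one] at a
      linarith
    have h6 : 0 ≤ 1 - ‖proj m z‖ * ‖w‖ := by
      nlinarith [sq_nonneg (‖proj m z‖ - ‖w‖)]
    have h7 : (1 - ‖proj m z‖ * ‖w‖) ^ 2 ≤ ‖1 - inner ℂ (proj m z) w‖ ^ 2 :=
      pow_le_pow_left₀ h6 h5 2
    have h8 : (1 - ‖proj m z‖ ^ 2) * (1 - ‖w‖ ^ 2) ≤ ‖1 - inner ℂ (proj m z) w‖ ^ 2 := by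
      nlinarith [sq_nonneg (‖proj m z‖ - ‖w‖)]
    nlinarith

theorem proj_single (m : ℕ) (c : ℂ) : proj m (EuclideanSpace.single (Fin.last m) c) = 0 := by
  ext k
  simp [Fin.castSucc_ne_last]

theorem dTheta_apply (m : ℕ) (z v : Cvec (m + 1)) :
    dTheta m z v = -((z (Fin.last m))⁻¹ * v (Fin.last m)).im
      - (1 - ‖proj m z‖ ^ 2)⁻¹ * (inner ℂ (proj m z) (proj m v)).im := by
  simp [dTheta, imForm]

theorem dTheta_ddTheta (m : ℕ) (z : Cvec (m + 1)) (hz : z ∈ punctured m) :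
    dTheta m z (ddTheta m z) = 1 := by
  have h := hz.2
  rw [dTheta_apply, ddTheta, proj_single]
  have : (z (Fin.last m))⁻¹ * (-Complex.I * z (Fin.last m)) = -Complex.I := by field_simp
  simp only [PiLp.single_apply, if_true]
  rw [this]; simp

theorem dTheta_ddU (m : ℕ) (z : Cvec (m + 1)) (hz : z ∈ punctured m) :
    dTheta m z (ddU m z) = 0 := by
  have h := hz.2
  rw [ddU, map_smul, dTheta_apply, euler, proj_single]
  simp [h]

theorem dTheta_horizontal (m : ℕ) (z v : Cvec (m + 1)) (hz : z ∈ punctured m)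
    (hv : IsHorizontal m z v) : dTheta m z v = 0 := by
  obtain ⟨h1, h2, h3⟩ := punctured_pos m z hz.1
  have hn : 0 < Complex.normSq (z (Fin.last m)) := Complex.normSq_pos.2 hz.2
  have h := hv (ddTheta m z) (by rw [ddTheta, proj_single])
  rw [chMetric_apply, inner_eq m v, inner_eq m z v, inner_eq m z, dTheta_apply] at *
  rw [ddTheta, proj_single] at h
  simp only [PiLp.single_apply, if_true] at h
  rw [h2] at h
  have h4 : 1 - ‖proj m z‖ ^ 2 - Complex.normSq (z (Fin.last m)) ≠ 0 := by rw [← h2]; exact h1.ne'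
  generalize inner ℂ (proj m z) (proj m v) = a at *
  generalize z (Fin.last m) = ζ at *
  generalize v (Fin.last m) = ν at *
  generalize 1 - ‖proj m z‖ ^ 2 = S at *
  rw [Complex.inv_def]
  obtain ⟨a₁, a₂⟩ := a
  obtain ⟨x, y⟩ := ζ
  obtain ⟨p, q⟩ := ν
  simp [Complex.normSq_apply] at hn h4 h ⊢
  have hD : S - (x ^ 2 + y ^ 2) ≠ 0 := by rwa [sq, sq]
  have hN : x ^ 2 + y ^ 2 ≠ 0 := by rw [sq, sq]; exact hn.ne'
  field_simp at h ⊢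
  linarith

theorem radial_pos (m : ℕ) (z : Cvec (m + 1)) (hz : ‖z‖ < 1) : 0 < radial m z := by
  obtain ⟨h1, h2, h3⟩ := punctured_pos m z hz
  exact Real.sqrt_pos.2 (by positivity)

theorem radial_sq (m : ℕ) (z : Cvec (m + 1)) (hz : ‖z‖ < 1) :
    radial m z ^ 2 = (1 - ‖proj m z‖ ^ 2) / (1 - ‖z‖ ^ 2) := by
  obtain ⟨h1, h2, h3⟩ := punctured_pos m z hz
  exact Real.sq_sqrt (by positivity)

theorem du_apply (m : ℕ) (z v : Cvec (m + 1)) (hz : ‖z‖ < 1) :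
    du m z v = (radial m z)⁻¹ * ((1 - ‖proj m z‖ ^ 2) * (inner ℂ z v).re
      - (1 - ‖z‖ ^ 2) * (inner ℂ (proj m z) (proj m v)).re) / (1 - ‖z‖ ^ 2) ^ 2 := by
  obtain ⟨h1, h2, h3⟩ := punctured_pos m z hz
  have re : ∀ (k : ℕ) (x y : Cvec k), inner ℝ x y = (inner ℂ x y).re := by
    intro k x y; simp [PiLp.inner_apply]
  have hB : HasFDerivAt (fun y : Cvec (m + 1) => 1 - ‖y‖ ^ 2) (-((2 : ℕ) • innerSL ℝ z)) z := by
    simpa using ((hasStrictFDerivAt_norm_sq z).hasFDerivAt).const_sub 1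
  have hA : HasFDerivAt (fun y : Cvec (m + 1) => 1 - ‖proj m y‖ ^ 2)
      (-(((2 : ℕ) • innerSL ℝ (proj m z)).comp (proj m))) z := by
    have := ((hasStrictFDerivAt_norm_sq (proj m z)).hasFDerivAt).comp z (proj m).hasFDerivAt
    simpa using this.const_sub 1
  have hq := (hA.fun_mul ((hasDerivAt_inv h1.ne').comp_hasFDerivAt z hB)).sqrt
    (mul_pos h3 (inv_pos.2 h1)).ne'
  have : du m z = _ := hq.fderiv
  rw [this, radial, div_eq_mul_inv (1 - ‖proj m z‖ ^ 2) (1 - ‖z‖ ^ 2)]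
  simp only [Function.comp_apply]
  generalize √((1 - ‖proj m z‖ ^ 2) * (1 - ‖z‖ ^ 2)⁻¹) = t
  simp [re]
  field_simp
  ring

theorem du_ddU (m : ℕ) (z : Cvec (m + 1)) (hz : z ∈ punctured m) :
    du m z (ddU m z) = 1 := by
  obtain ⟨h1, h2, h3⟩ := punctured_pos m z hz.1
  have hu := radial_pos m z hz.1
  have hn : 0 < Complex.normSq (z (Fin.last m)) := Complex.normSq_pos.2 hz.2
  rw [ddU, map_smul, smul_eq_mul]
  apply inv_mul_cancel₀
  rw [du_apply m z _ hz.1, inner_eq, euler, proj_single]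
  simp only [PiLp.single_apply, if_true, inner_zero_right, zero_add, ← Complex.normSq_eq_conj_mul_self]
  simp only [Complex.ofReal_re, Complex.zero_re, mul_zero, sub_zero]
  positivity

/-- For `W(u) = √(u² - 1)` the warped metric is the complex hyperbolic metric:
`𝔠_(m+1) = u² 𝔠_m + u² (u² - 1) dθ² + (u² - 1)⁻¹ du²`. -/
theorem warped_sqrt (m : ℕ) (z : Cvec (m + 1)) (hz : z ∈ punctured m) :
    warped m (fun u => √(u ^ 2 - 1)) z = chMetric (m + 1) z := by
  obtain ⟨h1, h2, h3⟩ := punctured_pos m z hz.1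
  have hu := radial_pos m z hz.1
  have hu2 := radial_sq m z hz.1
  have hn : 0 < Complex.normSq (z (Fin.last m)) := Complex.normSq_pos.2 hz.2
  have hW : radial m z ^ 2 - 1 = Complex.normSq (z (Fin.last m)) / (1 - ‖z‖ ^ 2) := by
    rw [hu2]; field_simp; linarith
  have hW2 : √(radial m z ^ 2 - 1) ^ 2 = Complex.normSq (z (Fin.last m)) / (1 - ‖z‖ ^ 2) := by
    rw [Real.sq_sqrt (by rw [hW]; positivity), hW]
  ext v w
  have expand : warped m (fun u => √(u ^ 2 - 1)) z v w
      = radial m z ^ 2 * chMetric m (proj m z) (proj m v) (proj m w)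
        + radial m z ^ 2 * √(radial m z ^ 2 - 1) ^ 2 * (dTheta m z v * dTheta m z w)
        + (√(radial m z ^ 2 - 1) ^ 2)⁻¹ * (du m z v * du m z w) := by
    simp [warped]
  have hdu : ∀ a b : ℝ, ((radial m z)⁻¹ * a / (1 - ‖z‖ ^ 2) ^ 2)
      * ((radial m z)⁻¹ * b / (1 - ‖z‖ ^ 2) ^ 2)
      = (radial m z ^ 2)⁻¹ * (a * b) / (1 - ‖z‖ ^ 2) ^ 4 := by
    intro a b; field_simp
  rw [expand, du_apply m z v hz.1, du_apply m z w hz.1, hdu, hW2, hu2]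
  simp only [chMetric_apply, dTheta_apply]
  rw [inner_eq m v w, inner_eq m z v, inner_eq m z w, h2]
  rw [h2] at h1
  clear expand hdu hW hW2 hu2 hu h2
  obtain ⟨-, hz⟩ := hz
  generalize inner ℂ (proj m z) (proj m v) = a at *
  generalize inner ℂ (proj m z) (proj m w) = b at *
  generalize inner ℂ (proj m v) (proj m w) = c at *
  generalize z (Fin.last m) = ζ at *
  generalize v (Fin.last m) = ν at *
  generalize w (Fin.last m) = ξ at *
  generalize 1 - ‖proj m z‖ ^ 2 = S at *
  rw [Complex.inv_def]
  obtain ⟨a₁, a₂⟩ := a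
  obtain ⟨b₁, b₂⟩ := b
  obtain ⟨c₁, c₂⟩ := c
  obtain ⟨x, y⟩ := ζ
  obtain ⟨p, q⟩ := ν
  obtain ⟨r, s⟩ := ξ
  simp [Complex.normSq_apply] at hn h1 ⊢
  have hD : S - (x ^ 2 + y ^ 2) ≠ 0 := by rw [sq, sq]; linarith
  have hN : x ^ 2 + y ^ 2 ≠ 0 := by rw [sq, sq]; exact hn.ne'
  field_simp
  ring

/-! ### Frames and indices -/

/-- `X 1, …, X (2m)` is (the value at `z` of) a holomorphic frame of the horizontal distribution:
each `X i` is horizontal, and the `dφ(X i)` form a `𝔠_m`-orthonormal basis of `T_φ(z) ℂℍ^m` with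
`dφ(X (i + 1)) = J dφ(X i)` for `i` odd. -/
structure IsHolomorphicFrame (m : ℕ) (z : Cvec (m + 1)) (X : ℕ → Cvec (m + 1)) : Prop where
  horizontal : ∀ i ∈ Finset.Icc 1 (2 * m), IsHorizontal m z (X i)
  orthonormal : ∀ i ∈ Finset.Icc 1 (2 * m), ∀ j ∈ Finset.Icc 1 (2 * m),
    chMetric m (proj m z) (proj m (X i)) (proj m (X j)) = if i = j then 1 else 0
  holomorphic : ∀ i ∈ Finset.Icc 1 (2 * m), Odd i →
    proj m (X (i + 1)) = Complex.I • proj m (X i)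

/-- The frame `Y_i = X_i / u` for `1 ≤ i ≤ 2n - 2`, `Y_(2n-1) = (1 / (u W)) ∂/∂θ`,
`Y_(2n) = W ∂/∂u`, where `n = m + 1`. -/
def frame (m : ℕ) (W : ℝ → ℝ) (z : Cvec (m + 1)) (X : ℕ → Cvec (m + 1)) (i : ℕ) :
    Cvec (m + 1) :=
  if i ≤ 2 * m then (1 / radial m z) • X i
  else if i = 2 * m + 1 then (1 / (radial m z * W (radial m z))) • ddTheta m z
  else W (radial m z) • ddU m z

/-- `i` and `j` are the indices of a holomorphic pair of the frame. -/
def HolPair (i j : ℕ) : Prop :=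
  (Odd i ∧ j = i + 1) ∨ (Odd j ∧ i = j + 1)

/-- The index quadruples that are listed in the curvature formulas (with `n = m + 1`), closed under
the symmetries `R_abcd = -R_bacd = -R_abdc = R_cdab` of the curvature tensor. -/
inductive Listed (m : ℕ) : ℕ → ℕ → ℕ → ℕ → Prop
  | hol (i : ℕ) : i ∈ Finset.Icc 1 (2 * m) → Odd i → Listed m i (i + 1) i (i + 1)
  | nonhol (i j : ℕ) : i ∈ Finset.Icc 1 (2 * m) → j ∈ Finset.Icc 1 (2 * m) → i ≠ j →
      ¬ HolPair i j → Listed m i j i j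
  | theta (i : ℕ) : i ∈ Finset.Icc 1 (2 * m) → Listed m i (2 * m + 1) i (2 * m + 1)
  | radius (i : ℕ) : i ∈ Finset.Icc 1 (2 * m) → Listed m i (2 * m + 2) i (2 * m + 2)
  | fibre : Listed m (2 * m + 1) (2 * m + 2) (2 * m + 1) (2 * m + 2)
  | mixed₁ (i j : ℕ) : i ∈ Finset.Icc 1 (2 * m) → j ∈ Finset.Icc 1 (2 * m) → Odd i → Odd j →
      i ≠ j → Listed m i (i + 1) j (j + 1)
  | mixed₂ (i j : ℕ) : i ∈ Finset.Icc 1 (2 * m) → j ∈ Finset.Icc 1 (2 * m) → Odd i → Odd j →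
      i ≠ j → Listed m i j (i + 1) (j + 1)
  | mixed₃ (i j : ℕ) : i ∈ Finset.Icc 1 (2 * m) → j ∈ Finset.Icc 1 (2 * m) → Odd i → Odd j →
      i ≠ j → Listed m i (j + 1) (i + 1) j
  | fibreMixed₁ (i : ℕ) : i ∈ Finset.Icc 1 (2 * m) → Odd i →
      Listed m i (i + 1) (2 * m + 1) (2 * m + 2)
  | fibreMixed₂ (i : ℕ) : i ∈ Finset.Icc 1 (2 * m) → Odd i →
      Listed m i (2 * m + 1) (i + 1) (2 * m + 2)
  | fibreMixed₃ (i : ℕ) : i ∈ Finset.Icc 1 (2 * m) → Odd i →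
      Listed m i (2 * m + 2) (i + 1) (2 * m + 1)
  | swap_left (a b c d : ℕ) : Listed m a b c d → Listed m b a c d
  | swap_right (a b c d : ℕ) : Listed m a b c d → Listed m a b d c
  | swap_pairs (a b c d : ℕ) : Listed m a b c d → Listed m c d a b

end CHWarp

end

open CHWarp

open scoped ContDiff

noncomputable section

namespace CHWarp

/-! Geometrically, `φ` has fibres with metric `u²W²dθ² + W⁻²du²`, the horizontal metric is the base
metric scaled by `u²`, and `dθ` is a connection form with `d(dθ) = -2Ω`, where `Ω` is the Kähler
form of the base. Each value can be predicted from this. On horizontal planes the base curvature is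
divided by `u²`; the warping adds `-W²/u²` because `|∇u| = W`; the O'Neill terms of `[X_i, X_(i+1)]
= 2 ∂/∂θ`, with `|∂/∂θ| = uW`, supply what is missing for the base curvature tensor to reappear with
factor `(1 + W²)/u²`. With `d/dr = W d/du`, a plane spanned by a horizontal and the radial vector
has curvature `-u_rr/u = -WW'/u`; for the angular vector the warping gives `-WW'/u - W²/u²`, and the
O'Neill term returns `W²/u²`. A fibre is the surface `dr² + (uW)²dθ²`, of Gauss curvature
`-(uW)_rr/(uW)`.

The proof is a direct computation in the ball chart with constant vector fields. A tangent vector is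
recorded by its three components under `proj`, `dTheta` and `du`, and the metric depends on these
alone. The Koszul formula yields the components of the connection (`dTheta_christoffel`,
`du_christoffel`, `proj_christoffel`); differentiating them once more yields those of the curvature
(`proj_curvature`, `dTheta_curvature`, `du_curvature`). The Hessian of `u` and the full derivative
of `dθ` are never evaluated: closedness of `du`, the exterior derivative of `dθ`
(`fderiv_dTheta_sub`), symmetry of second derivatives and the curvature of the base
(`chGamma_curvature`) suffice for all such terms to cancel.

The outcome, `riemann_warped`, is a polynomial in the base metric, `Ω`, `du` and `dθ`. On the frame
these become constant matrices and the curvature becomes `frameCurvature`, a combination of products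
of two matrix entries with three coefficients. The listed values are evaluations of it; the other
components vanish because a nonzero product forces a listed index pattern. -/

/-! ### Hermitian algebra of the complex hyperbolic metric and its connection. -/

/-- The Hermitian form whose real part is `chMetric`. -/
def chHerm {k : ℕ} (w v z : Cvec k) : ℂ :=
  (((1 - ‖w‖ ^ 2)⁻¹ : ℝ) : ℂ) * inner ℂ v z
    + (((1 - ‖w‖ ^ 2)⁻¹ : ℝ) : ℂ) ^ 2 * (inner ℂ v w * inner ℂ w z)

/-- The Levi-Civita connection of `chMetric` on constant vector fields. -/
def chGamma {k : ℕ} (w v z : Cvec k) : Cvec k :=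
  (((1 - ‖w‖ ^ 2)⁻¹ : ℝ) : ℂ) • (inner ℂ w v • z + inner ℂ w z • v)

theorem chMetric_eq_re {k : ℕ} (w v z : Cvec k) : chMetric k w v z = (chHerm w v z).re := by
  rw [chMetric_apply, chHerm, inner_conj_symm]
  simp [← Complex.ofReal_pow, Complex.re_ofReal_mul, -Complex.ofReal_inv, -Complex.mul_re]

theorem chHerm_smul_left {k : ℕ} (c : ℂ) (w v z : Cvec k) :
    chHerm w (c • v) z = starRingEnd ℂ c * chHerm w v z := by
  simp only [chHerm, inner_smul_left]; ring

theorem chHerm_smul_right {k : ℕ} (c : ℂ) (w v z : Cvec k) :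
    chHerm w v (c • z) = c * chHerm w v z := by
  simp only [chHerm, inner_smul_right]; ring

theorem chHerm_conj {k : ℕ} (w v z : Cvec k) :
    starRingEnd ℂ (chHerm w v z) = chHerm w z v := by
  simp only [chHerm, map_add, map_mul, map_pow, inner_conj_symm, Complex.conj_ofReal]; ring

theorem chMetric_symm {k : ℕ} (w v z : Cvec k) : chMetric k w v z = chMetric k w z v := by
  rw [chMetric_eq_re, chMetric_eq_re, ← chHerm_conj, Complex.conj_re]

theorem chMetric_I_left {k : ℕ} (w v z : Cvec k) :
    chMetric k w (Complex.I • v) z = (chHerm w v z).im := by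
  rw [chMetric_eq_re, chHerm_smul_left]; simp

theorem chMetric_I_right {k : ℕ} (w v z : Cvec k) :
    chMetric k w v (Complex.I • z) = -(chHerm w v z).im := by
  rw [chMetric_eq_re, chHerm_smul_right]; simp

theorem chMetric_I_swap {k : ℕ} (w v z : Cvec k) :
    chMetric k w (Complex.I • v) z = -chMetric k w (Complex.I • z) v := by
  rw [chMetric_symm, chMetric_I_right, chMetric_I_left]

theorem chMetric_I_I {k : ℕ} (w v z : Cvec k) :
    chMetric k w (Complex.I • v) (Complex.I • z) = chMetric k w v z := by
  rw [chMetric_eq_re, chMetric_eq_re, chHerm_smul_left, chHerm_smul_right]; simp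

theorem chMetric_pos {k : ℕ} {w v : Cvec k} (hw : 0 < 1 - ‖w‖ ^ 2) (hv : v ≠ 0) :
    0 < chMetric k w v v := by
  have h : 0 < ‖v‖ := norm_pos_iff.2 hv
  rw [chMetric_apply, inner_self_eq_norm_sq_to_K, mul_comm (starRingEnd ℂ _), Complex.mul_conj]
  have h2 := Complex.normSq_nonneg (inner ℂ w v)
  have : (((‖v‖ : ℂ)) ^ 2).re = ‖v‖ ^ 2 := by rw [← Complex.ofReal_pow, Complex.ofReal_re]
  have h3 : ((RCLike.ofReal ‖v‖ : ℂ) ^ 2).re = ‖v‖ ^ 2 := this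
  rw [h3, Complex.ofReal_re]
  positivity

/-- Nondegeneracy by positivity. It serves to identify the horizontal part of the connection, which
is known only through its pairings with base vectors. -/
theorem eq_of_chMetric_eq {k : ℕ} {w v v' : Cvec k} (hw : 0 < 1 - ‖w‖ ^ 2)
    (h : ∀ z, chMetric k w v z = chMetric k w v' z) : v = v' := by
  by_contra hne
  have := chMetric_pos hw (sub_ne_zero.2 hne)
  have h2 := h (v - v')
  have h3 : chMetric k w (v - v') (v - v')
      = chMetric k w v (v - v') - chMetric k w v' (v - v') := by simp
  rw [h3, h2, sub_self] at this
  exact lt_irrefl _ this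

theorem chGamma_symm {k : ℕ} (w v z : Cvec k) : chGamma w v z = chGamma w z v := by
  rw [chGamma, chGamma, add_comm]

theorem chGamma_smul_right {k : ℕ} (c : ℂ) (w v z : Cvec k) :
    chGamma w v (c • z) = c • chGamma w v z := by
  simp only [chGamma, inner_smul_right]; module

theorem chGamma_real_smul_right {k : ℕ} (c : ℝ) (w v z : Cvec k) :
    chGamma w v (c • z) = c • chGamma w v z := by
  have := chGamma_smul_right (c : ℂ) w v z
  simpa only [Complex.coe_smul] using this

theorem chGamma_add_right {k : ℕ} (w v z z' : Cvec k) :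
    chGamma w v (z + z') = chGamma w v z + chGamma w v z' := by
  simp only [chGamma, inner_add_right]; module

theorem re_eq_real_inner {k : ℕ} (x y : Cvec k) : (inner ℂ x y).re = inner ℝ x y := by
  simp [PiLp.inner_apply]

/-! ### Derivatives along straight lines, and the curvature of the base. -/

section Deriv

variable {k : ℕ} {w b : Cvec k}

theorem hasDerivAt_line (w b : Cvec k) : HasDerivAt (fun t : ℝ => w + t • b) b 0 := by
  simpa using ((hasDerivAt_id (0 : ℝ)).smul_const b).const_add w

theorem hasDerivAt_inv_line (hw : 0 < 1 - ‖w‖ ^ 2) :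
    HasDerivAt (fun t : ℝ => (1 - ‖w + t • b‖ ^ 2)⁻¹)
      (2 * (inner ℂ w b).re * ((1 - ‖w‖ ^ 2)⁻¹) ^ 2) 0 := by
  have h := ((hasDerivAt_line w b).norm_sq.const_sub 1).fun_inv (by simpa using hw.ne')
  refine h.congr_deriv ?_
  rw [re_eq_real_inner, zero_smul, add_zero]
  field_simp

theorem hasDerivAt_inner_line (a : Cvec k) :
    HasDerivAt (fun t : ℝ => inner ℂ (w + t • b) a) (inner ℂ b a) 0 := by
  refine ((hasDerivAt_line w b).inner ℂ (hasDerivAt_const (0 : ℝ) a)).congr_deriv ?_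
  simp

theorem hasDerivAt_inner_line' (a : Cvec k) :
    HasDerivAt (fun t : ℝ => inner ℂ a (w + t • b)) (inner ℂ a b) 0 := by
  refine ((hasDerivAt_const (0 : ℝ) a).inner ℂ (hasDerivAt_line w b)).congr_deriv ?_
  simp

theorem two_mul_re_inner (x : Cvec k) (y : Cvec k) :
    ((2 * (inner ℂ x y).re : ℝ) : ℂ) = inner ℂ x y + inner ℂ y x := by
  rw [← inner_conj_symm y x, Complex.add_conj]

/-- Metric compatibility of `chGamma`. Together with `chGamma_symm` it makes `chGamma` the
Levi-Civita connection. Working with the Hermitian form gives the metric and the Kähler form at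
once, as `chGamma` is complex bilinear. -/
theorem hasDerivAt_chHerm_line (hw : 0 < 1 - ‖w‖ ^ 2) (a c : Cvec k) :
    HasDerivAt (fun t : ℝ => chHerm (w + t • b) a c)
      (chHerm w (chGamma w b a) c + chHerm w a (chGamma w b c)) 0 := by
  have hS := (hasDerivAt_inv_line (b := b) hw).ofReal_comp
  have h := (hS.mul_const (inner ℂ a c)).fun_add ((hS.fun_pow 2).fun_mul
    ((hasDerivAt_inner_line' (w := w) (b := b) a).fun_mul (hasDerivAt_inner_line (w := w) (b := b) c)))
  refine h.congr_deriv ?_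
  rw [Complex.ofReal_mul, two_mul_re_inner]
  simp only [zero_smul, add_zero, chHerm, chGamma, inner_smul_left, inner_smul_right,
    inner_add_left, inner_add_right, inner_conj_symm, Complex.conj_ofReal]
  push_cast
  ring

theorem hasDerivAt_chMetric_line (hw : 0 < 1 - ‖w‖ ^ 2) (a c : Cvec k) :
    HasDerivAt (fun t : ℝ => chMetric k (w + t • b) a c)
      (chMetric k w (chGamma w b a) c + chMetric k w a (chGamma w b c)) 0 := by
  simp only [chMetric_eq_re]
  rw [← Complex.add_re]
  exact (Complex.reCLM.hasFDerivAt.comp_hasDerivAt (0 : ℝ) (hasDerivAt_chHerm_line hw a c))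

/-- The derivative of `chGamma w a c` in the direction `b`. -/
def chGammaDeriv (w b a c : Cvec k) : Cvec k :=
  (((1 - ‖w‖ ^ 2)⁻¹ : ℝ) : ℂ) • (inner ℂ b a • c + inner ℂ b c • a)
    + ((inner ℂ w b + inner ℂ b w) * (((1 - ‖w‖ ^ 2)⁻¹ : ℝ) : ℂ) ^ 2) •
      (inner ℂ w a • c + inner ℂ w c • a)

theorem hasDerivAt_chGamma_line (hw : 0 < 1 - ‖w‖ ^ 2) (a c : Cvec k) :
    HasDerivAt (fun t : ℝ => chGamma (w + t • b) a c) (chGammaDeriv w b a c) 0 := by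
  have hS := (hasDerivAt_inv_line (b := b) hw).ofReal_comp
  have h := hS.fun_smul (((hasDerivAt_inner_line (w := w) (b := b) a).smul_const c).fun_add
    ((hasDerivAt_inner_line (w := w) (b := b) c).smul_const a))
  refine h.congr_deriv ?_
  rw [Complex.ofReal_mul, two_mul_re_inner]
  simp only [zero_smul, add_zero, chGammaDeriv]
  push_cast
  rfl

/-- `chMetric` has constant holomorphic sectional curvature `-4`. -/
theorem chGamma_curvature (w a b c : Cvec k) :
    chGammaDeriv w b a c + chGamma w b (chGamma w a c)
      - (chGammaDeriv w a b c + chGamma w a (chGamma w b c))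
    = chMetric k w b c • a + chMetric k w (Complex.I • b) c • (Complex.I • a)
      - (chMetric k w a c • b + chMetric k w (Complex.I • a) c • (Complex.I • b))
      - (2 * chMetric k w (Complex.I • a) b) • (Complex.I • c) := by
  -- Coefficients of `v` and `I • v` given by the metric and the Kähler form fold into one complex
  -- scalar, a value of `chHerm`. The claim becomes a complex linear identity in `a`, `b`, `c`.
  have hs : ∀ (z : ℂ) (v : Cvec k), z.re • v + z.im • (Complex.I • v) = z • v := by
    intro z v
    conv_rhs => rw [← Complex.re_add_im z]
    rw [add_smul, mul_smul, Complex.coe_smul, Complex.coe_smul]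
  have h2 : (2 * (chHerm w a b).im) • (Complex.I • c) = (chHerm w a b - chHerm w b a) • c := by
    rw [← chHerm_conj w a b, Complex.sub_conj, mul_smul _ Complex.I, Complex.coe_smul]
  simp only [chMetric_I_left]
  simp only [chMetric_eq_re, hs, h2]
  simp only [chGammaDeriv, chGamma, chHerm]
  simp only [inner_smul_right, inner_add_right]
  module

end Deriv

/-! ### Smoothness criteria and Levi-Civita calculus for a general metric. -/

theorem contDiffAt_clm_apply_of_forall {E F G : Type*} [NormedAddCommGroup E] [NormedSpace ℝ E]
    [NormedAddCommGroup F] [NormedSpace ℝ F] [FiniteDimensional ℝ F] [NormedAddCommGroup G]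
    [NormedSpace ℝ G] {f : E → F →L[ℝ] G} {x : E} {n : WithTop ℕ∞}
    (h : ∀ y, ContDiffAt ℝ n (fun x => f x y) x) : ContDiffAt ℝ n f x := by
  -- Coordinates on `F` identify `F →L[ℝ] G` with a finite power of `G`, whose coordinates are
  -- evaluations at basis vectors.
  let e₁ := ContinuousLinearEquiv.ofFinrankEq
    (show Module.finrank ℝ F = Module.finrank ℝ (Fin (Module.finrank ℝ F) → ℝ) by simp)
  let e₂ := (e₁.arrowCongr (ContinuousLinearEquiv.refl ℝ G)).trans
    (ContinuousLinearEquiv.piRing (Fin (Module.finrank ℝ F)))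
  rw [← e₂.comp_contDiffAt_iff]
  exact contDiffAt_pi.2 fun i => h _

theorem contDiffAt_chMetric {k : ℕ} {w : Cvec k} (hw : 0 < 1 - ‖w‖ ^ 2) :
    ContDiffAt ℝ ∞ (chMetric k) w := by
  have hS : ContDiffAt ℝ ∞ (fun w : Cvec k => (1 - ‖w‖ ^ 2)⁻¹) w :=
    (contDiffAt_const.sub (contDiffAt_id.norm_sq ℝ)).inv hw.ne'
  refine contDiffAt_clm_apply_of_forall fun a => contDiffAt_clm_apply_of_forall fun c => ?_
  simp only [chMetric_eq_re, chHerm]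
  have hS' := Complex.ofRealCLM.contDiff.contDiffAt.fun_comp w hS
  exact Complex.reCLM.contDiff.contDiffAt.fun_comp w <|
    (hS'.mul contDiffAt_const).add ((hS'.pow 2).mul
      ((contDiffAt_const.inner ℂ contDiffAt_id).mul (contDiffAt_id.inner ℂ contDiffAt_const)))

section General

variable {E G : Type*} [NormedAddCommGroup E] [NormedSpace ℝ E] [NormedAddCommGroup G]
  [NormedSpace ℝ G]

theorem hasDerivAt_comp_line {f : E → G} {x : E} (hf : DifferentiableAt ℝ f x) (b : E) :
    HasDerivAt (fun t : ℝ => f (x + t • b)) (fderiv ℝ f x b) 0 :=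
  hf.hasFDerivAt.hasLineDerivAt b

theorem hasDerivAt_clm_apply_line {f : E → E →L[ℝ] G} {x : E} (hf : DifferentiableAt ℝ f x)
    (b v : E) : HasDerivAt (fun t : ℝ => f (x + t • b) v) (fderiv ℝ f x b v) 0 :=
  (ContinuousLinearMap.apply ℝ G v).hasFDerivAt.comp_hasDerivAt (0 : ℝ) (hasDerivAt_comp_line hf b)

theorem fderiv_fderiv_symm {f : E → G} {x : E} (hf : ContDiffAt ℝ ∞ f x) (a b : E) :
    fderiv ℝ (fderiv ℝ f) x a b = fderiv ℝ (fderiv ℝ f) x b a :=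
  (hf.isSymmSndFDerivAt (by
    rw [minSmoothness_of_isRCLikeNormedField]; exact WithTop.coe_le_coe.2 le_top)).eq a b

theorem contDiffAt_fderiv {f : E → G} {x : E} (hf : ContDiffAt ℝ ∞ f x) :
    ContDiffAt ℝ ∞ (fderiv ℝ f) x :=
  hf.fderiv_right (by simp)

theorem isInvertible_of_injective [FiniteDimensional ℝ E] (A : E →L[ℝ] E →L[ℝ] ℝ)
    (hA : ∀ v, A v = 0 → v = 0) : A.IsInvertible := by
  have hinj : Function.Injective (A : E →ₗ[ℝ] E →L[ℝ] ℝ) :=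
    (injective_iff_map_eq_zero _).2 hA
  have hdim : Module.finrank ℝ E = Module.finrank ℝ (E →L[ℝ] ℝ) := by
    rw [← (LinearMap.toContinuousLinearMap (𝕜 := ℝ) (E := E) (F' := ℝ)).finrank_eq]
    exact (Subspace.dual_finrank_eq (K := ℝ) (V := E)).symm
  refine ⟨(LinearEquiv.ofInjectiveOfFinrankEq _ hinj hdim).toContinuousLinearEquiv, ?_⟩
  ext v w
  rfl

/-- `inverse` has the default value `0` on non-invertible maps, so the Koszul formula holds for
`christoffel` only where the metric is nondegenerate. -/
theorem apply_christoffel {g : E → E →L[ℝ] E →L[ℝ] ℝ} {x : E} (hg : (g x).IsInvertible)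
    (v w z : E) :
    g x (christoffel g x v w) z
      = 1 / 2 * (fderiv ℝ g x v w z + fderiv ℝ g x w v z - fderiv ℝ g x z v w) := by
  rw [christoffel, hg.self_apply_inverse]
  simp

theorem contDiffAt_christoffel [FiniteDimensional ℝ E] {g : E → E →L[ℝ] E →L[ℝ] ℝ} {x : E}
    (hg : (g x).IsInvertible) (h : ContDiffAt ℝ ∞ g x) (v w : E) :
    ContDiffAt ℝ ∞ (fun y => christoffel g y v w) x := by
  have := FiniteDimensional.complete ℝ E
  have h' := contDiffAt_fderiv h
  obtain ⟨e, he⟩ := hg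
  have hi : ContDiffAt ℝ ∞ (fun y => (g y).inverse) x := by
    refine ContDiffAt.fun_comp x ?_ h
    rw [← he]
    exact contDiffAt_map_inverse e
  refine hi.clm_apply (contDiffAt_clm_apply_of_forall fun z => ?_)
  have hd : ∀ a b c, ContDiffAt ℝ ∞ (fun y => fderiv ℝ g y a b c) x := fun a b c =>
    ((h'.clm_apply contDiffAt_const).clm_apply contDiffAt_const).clm_apply contDiffAt_const
  simpa using (contDiffAt_const (c := (1 / 2 : ℝ))).mul (((hd v w z).add (hd w v z)).sub (hd z v w))

/-- The curvature of constant vector fields in terms of the connection. -/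
theorem curvatureField_const (g : E → E →L[ℝ] E →L[ℝ] ℝ) (x a b c : E) :
    curvatureField g (fun _ => a) (fun _ => b) (fun _ => c) x
      = (fderiv ℝ (fun y => christoffel g y a c) x b + christoffel g x b (christoffel g x a c))
        - (fderiv ℝ (fun y => christoffel g y b c) x a
          + christoffel g x a (christoffel g x b c)) := by
  have h1 : ∀ v w : E, covDeriv g (fun _ => v) (fun _ => w) = fun y => christoffel g y v w := by
    intro v w; ext y; simp [covDeriv]
  have h2 : VectorField.lieBracket ℝ (fun _ : E => a) (fun _ => b) = fun _ => 0 := by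
    ext y; simp [VectorField.lieBracket]
  have h3 : ∀ w : E, christoffel g x 0 w = 0 := by
    intro w
    have : fderiv ℝ g x 0 w + fderiv ℝ g x w 0 - ((fderiv ℝ g x).flip 0).flip w = 0 := by
      ext; simp
    rw [christoffel, this]; simp
  rw [curvatureField, h2, h1, h1, h1]
  simp only [h3, add_zero, covDeriv]

end General

/-! ### The forms `dθ` and `du`, and the first derivatives of the warped metric. -/

variable {m : ℕ}

theorem isOpen_punctured (m : ℕ) : IsOpen (punctured m) :=
  (isOpen_lt continuous_norm continuous_const).inter
    (isOpen_ne_fun (lastCoord m).continuous continuous_const)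

theorem contDiffAt_dTheta {z : Cvec (m + 1)} (hz : z ∈ punctured m) :
    ContDiffAt ℝ ∞ (dTheta m) z := by
  obtain ⟨h1, h2, h3⟩ := punctured_pos m z hz.1
  refine contDiffAt_clm_apply_of_forall fun v => ?_
  simp only [dTheta_apply]
  have hp : ContDiffAt ℝ ∞ (fun y => proj m y) z := (proj m).contDiff.contDiffAt
  have hl : ContDiffAt ℝ ∞ (fun y : Cvec (m + 1) => y (Fin.last m)) z :=
    (lastCoord m).contDiff.contDiffAt
  have hS : ContDiffAt ℝ ∞ (fun y => (1 - ‖proj m y‖ ^ 2)⁻¹) z :=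
    (contDiffAt_const.sub (hp.norm_sq ℝ)).inv h3.ne'
  have hA := Complex.imCLM.contDiff.contDiffAt.fun_comp z
    ((hl.inv hz.2).mul (contDiffAt_const (c := v (Fin.last m))))
  have hB := Complex.imCLM.contDiff.contDiffAt.fun_comp z
    (hp.inner ℂ (contDiffAt_const (c := proj m v)))
  exact hA.neg.sub (hS.mul hB)

theorem contDiffAt_radial {z : Cvec (m + 1)} (hz : ‖z‖ < 1) : ContDiffAt ℝ ∞ (radial m) z := by
  obtain ⟨h1, h2, h3⟩ := punctured_pos m z hz
  have hp : ContDiffAt ℝ ∞ (fun y => proj m y) z := (proj m).contDiff.contDiffAt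
  exact ((contDiffAt_const.sub (hp.norm_sq ℝ)).div (contDiffAt_const.sub
    (contDiffAt_id.norm_sq ℝ)) h1.ne').sqrt (div_pos h3 h1).ne'

theorem contDiffAt_du {z : Cvec (m + 1)} (hz : ‖z‖ < 1) : ContDiffAt ℝ ∞ (du m) z :=
  contDiffAt_fderiv (contDiffAt_radial hz)

theorem fderiv_du_symm {z : Cvec (m + 1)} (hz : ‖z‖ < 1) (a b : Cvec (m + 1)) :
    fderiv ℝ (du m) z a b = fderiv ℝ (du m) z b a :=
  fderiv_fderiv_symm (contDiffAt_radial hz) a b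

theorem proj_line (z b : Cvec (m + 1)) (t : ℝ) : proj m (z + t • b) = proj m z + t • proj m b := by
  rw [map_add, map_smul]

theorem hasDerivAt_dTheta_line {z : Cvec (m + 1)} (hz : z ∈ punctured m) (b v : Cvec (m + 1)) :
    HasDerivAt (fun t : ℝ => dTheta m (z + t • b) v)
      ((((z (Fin.last m)) ^ 2)⁻¹ * b (Fin.last m) * v (Fin.last m)).im
        - (2 * (inner ℂ (proj m z) (proj m b)).re * ((1 - ‖proj m z‖ ^ 2)⁻¹) ^ 2
            * (inner ℂ (proj m z) (proj m v)).im
          + (1 - ‖proj m z‖ ^ 2)⁻¹ * (inner ℂ (proj m b) (proj m v)).im)) 0 := by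
  obtain ⟨h1, h2, h3⟩ := punctured_pos m z hz.1
  simp only [dTheta_apply, proj_line]
  have hl : HasDerivAt (fun t : ℝ => (z + t • b) (Fin.last m)) (b (Fin.last m)) 0 :=
    hasDerivAt_comp_line (lastCoord m).differentiableAt b |>.congr_deriv (by
      rw [(lastCoord m).fderiv]; rfl)
  have hA := Complex.imCLM.hasFDerivAt.comp_hasDerivAt (0 : ℝ)
    ((hl.fun_inv (by simpa using hz.2)).mul_const (v (Fin.last m)))
  have hB := Complex.imCLM.hasFDerivAt.comp_hasDerivAt (0 : ℝ)
    (hasDerivAt_inner_line (w := proj m z) (b := proj m b) (proj m v))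
  have h := hA.fun_neg.fun_sub ((hasDerivAt_inv_line (b := proj m b) h3).fun_mul hB)
  refine h.congr_deriv ?_
  simp only [Complex.imCLM_apply, Function.comp_apply, zero_smul, add_zero]
  rw [← Complex.neg_im]
  congr 2
  rw [div_eq_mul_inv]; ring

/-- This is `d(dθ) = -2Ω`. The fibre part of `dθ` is the imaginary part of a logarithmic
differential, hence closed; its derivative is visibly symmetric in `b` and `v`. What remains comes
from the base part and is the Kähler form, the obstruction to integrability of the horizontal
distribution. -/
theorem fderiv_dTheta_sub {z : Cvec (m + 1)} (hz : z ∈ punctured m) (b v : Cvec (m + 1)) :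
    fderiv ℝ (dTheta m) z b v = fderiv ℝ (dTheta m) z v b
      - 2 * chMetric m (proj m z) (Complex.I • proj m b) (proj m v) := by
  have hd := (contDiffAt_dTheta hz).differentiableAt (by simp)
  have h : ∀ b v, fderiv ℝ (dTheta m) z b v = _ := fun b v =>
    (hasDerivAt_clm_apply_line hd b v).unique (hasDerivAt_dTheta_line hz b v)
  rw [h, h, chMetric_I_left, chHerm]
  have e : (((z (Fin.last m)) ^ 2)⁻¹ * b (Fin.last m) * v (Fin.last m)).im
     = (((z (Fin.last m)) ^ 2)⁻¹ * v (Fin.last m) * b (Fin.last m)).im := by congr 1; ring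
  rw [e, ← inner_conj_symm (proj m b) (proj m z), ← inner_conj_symm (proj m v) (proj m b),
    ← Complex.ofReal_pow, Complex.add_im, Complex.im_ofReal_mul, Complex.im_ofReal_mul,
    Complex.mul_im (starRingEnd ℂ _), Complex.conj_im, Complex.conj_re, Complex.conj_im]
  ring

theorem warped_apply (W : ℝ → ℝ) (z v w : Cvec (m + 1)) :
    warped m W z v w = radial m z ^ 2 * chMetric m (proj m z) (proj m v) (proj m w)
      + radial m z ^ 2 * W (radial m z) ^ 2 * (dTheta m z v * dTheta m z w)
      + (W (radial m z) ^ 2)⁻¹ * (du m z v * du m z w) := by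
  simp [warped]

theorem contDiffAt_warped {W : ℝ → ℝ} {z : Cvec (m + 1)} (hz : z ∈ punctured m)
    (hW : ContDiffAt ℝ ∞ W (radial m z)) (hW0 : 0 < W (radial m z)) :
    ContDiffAt ℝ ∞ (warped m W) z := by
  obtain ⟨h1, h2, h3⟩ := punctured_pos m z hz.1
  refine contDiffAt_clm_apply_of_forall fun v => contDiffAt_clm_apply_of_forall fun w => ?_
  simp only [warped_apply]
  have hu := contDiffAt_radial hz.1
  have hWu := hW.fun_comp z hu
  have hc : ContDiffAt ℝ ∞ (fun y => chMetric m (proj m y)) z :=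
    (contDiffAt_chMetric h3).fun_comp z (proj m).contDiff.contDiffAt
  have hθ := contDiffAt_dTheta hz
  have hdu := contDiffAt_du hz.1
  exact (((hu.pow 2).mul ((hc.clm_apply contDiffAt_const).clm_apply contDiffAt_const)).add
    (((hu.pow 2).mul (hWu.pow 2)).mul ((hθ.clm_apply contDiffAt_const).mul
      (hθ.clm_apply contDiffAt_const)))).add (((hWu.pow 2).inv (pow_pos hW0 2).ne').mul
      ((hdu.clm_apply contDiffAt_const).mul (hdu.clm_apply contDiffAt_const)))

theorem hasDerivAt_radial_line {z : Cvec (m + 1)} (hz : ‖z‖ < 1) (b : Cvec (m + 1)) :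
    HasDerivAt (fun t : ℝ => radial m (z + t • b)) (du m z b) 0 :=
  hasDerivAt_comp_line ((contDiffAt_radial hz).differentiableAt (by simp)) b

theorem hasDerivAt_comp_radial_line {f : ℝ → ℝ} {z : Cvec (m + 1)} (hz : ‖z‖ < 1)
    {f' : ℝ} (hf : HasDerivAt f f' (radial m z)) (b : Cvec (m + 1)) :
    HasDerivAt (fun t : ℝ => f (radial m (z + t • b))) (f' * du m z b) 0 :=
  HasDerivAt.comp (0 : ℝ) (by simpa using hf) (hasDerivAt_radial_line hz b)

theorem hasDerivAt_du_line {z : Cvec (m + 1)} (hz : ‖z‖ < 1) (b v : Cvec (m + 1)) :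
    HasDerivAt (fun t : ℝ => du m (z + t • b) v) (fderiv ℝ (du m) z b v) 0 :=
  hasDerivAt_clm_apply_line ((contDiffAt_du hz).differentiableAt (by simp)) b v

theorem hasDerivAt_dTheta_line' {z : Cvec (m + 1)} (hz : z ∈ punctured m) (b v : Cvec (m + 1)) :
    HasDerivAt (fun t : ℝ => dTheta m (z + t • b) v) (fderiv ℝ (dTheta m) z b v) 0 :=
  hasDerivAt_clm_apply_line ((contDiffAt_dTheta hz).differentiableAt (by simp)) b v

theorem hasDerivAt_base_line {z : Cvec (m + 1)} (hz : ‖z‖ < 1) (b : Cvec (m + 1))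
    (v w : Cvec m) :
    HasDerivAt (fun t : ℝ => chMetric m (proj m (z + t • b)) v w)
      (chMetric m (proj m z) (chGamma (proj m z) (proj m b) v) w
        + chMetric m (proj m z) v (chGamma (proj m z) (proj m b) w)) 0 := by
  simp only [proj_line]
  exact hasDerivAt_chMetric_line (punctured_pos m z hz).2.2 v w

/-- Product rule, with the base metric differentiated through `chGamma`. The derivatives of `dTheta`
and `du` stay unevaluated, since they drop out later. -/
theorem fderiv_warped {W : ℝ → ℝ} {z : Cvec (m + 1)} (hz : z ∈ punctured m)
    (hW : ContDiffAt ℝ ∞ W (radial m z)) (hW0 : 0 < W (radial m z)) (b v w : Cvec (m + 1)) :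
    fderiv ℝ (warped m W) z b v w =
      2 * radial m z * du m z b * chMetric m (proj m z) (proj m v) (proj m w)
      + radial m z ^ 2 * (chMetric m (proj m z) (chGamma (proj m z) (proj m b) (proj m v))
          (proj m w) + chMetric m (proj m z) (proj m v) (chGamma (proj m z) (proj m b) (proj m w)))
      + 2 * radial m z * W (radial m z) * (W (radial m z) + radial m z * deriv W (radial m z))
        * du m z b * (dTheta m z v * dTheta m z w)
      + radial m z ^ 2 * W (radial m z) ^ 2 * (fderiv ℝ (dTheta m) z b v * dTheta m z w
        + dTheta m z v * fderiv ℝ (dTheta m) z b w)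
      - 2 * deriv W (radial m z) * (W (radial m z) ^ 3)⁻¹ * du m z b * (du m z v * du m z w)
      + (W (radial m z) ^ 2)⁻¹ * (fderiv ℝ (du m) z b v * du m z w
        + du m z v * fderiv ℝ (du m) z b w) := by
  have hg := (contDiffAt_warped hz hW hW0).differentiableAt (by simp)
  have h1 : HasDerivAt (fun t : ℝ => warped m W (z + t • b) v w)
      (fderiv ℝ (warped m W) z b v w) 0 :=
    (ContinuousLinearMap.apply ℝ ℝ w).hasFDerivAt.comp_hasDerivAt (0 : ℝ)
      (hasDerivAt_clm_apply_line hg b v)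
  simp only [warped_apply] at h1
  have hu := hasDerivAt_radial_line hz.1 b
  have hWu := hasDerivAt_comp_radial_line hz.1 (hW.differentiableAt (by simp)).hasDerivAt b
  have h2 := (((hu.fun_pow 2).fun_mul (hasDerivAt_base_line hz.1 b (proj m v) (proj m w))).fun_add
    (((hu.fun_pow 2).fun_mul (hWu.fun_pow 2)).fun_mul
      ((hasDerivAt_dTheta_line' hz b v).fun_mul (hasDerivAt_dTheta_line' hz b w)))).fun_add
    (((hWu.fun_pow 2).fun_inv (by simpa using hW0.ne')).fun_mul
      ((hasDerivAt_du_line hz.1 b v).fun_mul (hasDerivAt_du_line hz.1 b w)))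
  rw [h1.unique h2]
  simp only [zero_smul, add_zero]
  generalize W (radial m z) = W₀ at hW0 ⊢
  field_simp
  ring

theorem proj_ddTheta (z : Cvec (m + 1)) : proj m (ddTheta m z) = 0 := proj_single m _

theorem proj_ddU (z : Cvec (m + 1)) : proj m (ddU m z) = 0 := by
  rw [ddU, map_smul, euler, proj_single, smul_zero]

theorem du_ddTheta {z : Cvec (m + 1)} (hz : ‖z‖ < 1) : du m z (ddTheta m z) = 0 := by
  rw [du_apply m z _ hz, inner_eq, proj_ddTheta, ddTheta]
  simp
  exact Or.inl (Or.inr (Or.inr (by ring)))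

/-- On a vector tangent to the fibre, with last coordinate `ν` over the point `ζ`, the forms `dθ`
and `du` read off the imaginary and real parts of `conj ζ * ν` up to nonzero factors, and `ζ ≠ 0`.
-/
theorem eq_zero_of_proj_eq_zero {z v : Cvec (m + 1)} (hz : z ∈ punctured m)
    (hp : proj m v = 0) (hθ : dTheta m z v = 0) (hu : du m z v = 0) : v = 0 := by
  obtain ⟨h1, h2, h3⟩ := punctured_pos m z hz.1
  have hr := radial_pos m z hz.1
  rw [dTheta_apply, hp] at hθ
  rw [du_apply m z _ hz.1, inner_eq, hp] at hu
  simp [hr.ne', h1.ne', h3.ne'] at hu hθ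
  have hn : 0 < Complex.normSq (z (Fin.last m)) := Complex.normSq_pos.2 hz.2
  have hl : v (Fin.last m) = 0 := by
    have hn' := hn.ne'
    field_simp at hθ
    rw [Complex.normSq_apply] at hn'
    apply Complex.ext
    · refine (mul_eq_zero.1 ?_).resolve_left hn'
      linear_combination (z (Fin.last m)).re * hu + (z (Fin.last m)).im * hθ
    · refine (mul_eq_zero.1 ?_).resolve_left hn'
      linear_combination (z (Fin.last m)).im * hu - (z (Fin.last m)).re * hθ
  ext k
  induction k using Fin.lastCases with
  | last => exact hl
  | cast k => simpa using congrArg (fun y => y k) hp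

theorem proj_surjective (m : ℕ) (w : Cvec m) : ∃ v, proj m v = w := ⟨incl m w, proj_incl m w⟩

theorem isInvertible_warped {W : ℝ → ℝ} {z : Cvec (m + 1)} (hz : z ∈ punctured m)
    (hW0 : 0 < W (radial m z)) : (warped m W z).IsInvertible := by
  refine isInvertible_of_injective _ fun v hv => ?_
  have hv' : warped m W z v v = 0 := by rw [hv]; rfl
  rw [warped_apply] at hv'
  have hr := radial_pos m z hz.1
  by_contra hne
  have hp : proj m v = 0 := by
    by_contra hp
    have := chMetric_pos (punctured_pos m z hz.1).2.2 hp
    have : 0 < radial m z ^ 2 * chMetric m (proj m z) (proj m v) (proj m v) := by positivity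
    have : 0 ≤ radial m z ^ 2 * W (radial m z) ^ 2 * (dTheta m z v * dTheta m z v) :=
      mul_nonneg (by positivity) (mul_self_nonneg _)
    have : 0 ≤ (W (radial m z) ^ 2)⁻¹ * (du m z v * du m z v) :=
      mul_nonneg (by positivity) (mul_self_nonneg _)
    linarith
  refine hne (eq_zero_of_proj_eq_zero hz hp ?_ ?_)
  · have h := congrArg (fun A => A (ddTheta m z)) hv
    simpa [warped_apply, hp, dTheta_ddTheta m z hz, du_ddTheta hz.1, hr.ne', hW0.ne'] using h
  · have h := congrArg (fun A => A (ddU m z)) hv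
    simpa [warped_apply, hp, dTheta_ddU m z hz, du_ddU m z hz, hW0.ne'] using h

theorem chGamma_zero_left {k : ℕ} (w v : Cvec k) : chGamma w 0 v = 0 := by simp [chGamma]

theorem chGamma_zero_right {k : ℕ} (w v : Cvec k) : chGamma w v 0 = 0 := by simp [chGamma]

/-! ### The Levi-Civita connection of the warped metric in components. -/

section Components

variable {W : ℝ → ℝ} {z : Cvec (m + 1)}

/-- Koszul's formula is tested against `∂/∂θ`: only the `dθ²` term of the metric sees this vector,
so the pairing is `u²W²` times the wanted component. The Kähler form appears when the derivative of
`dθ` in direction `w` is traded for the one in direction `v`. -/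
theorem dTheta_christoffel (hz : z ∈ punctured m)
    (hW : ContDiffAt ℝ ∞ W (radial m z)) (hW0 : 0 < W (radial m z)) (v w : Cvec (m + 1)) :
    dTheta m z (christoffel (warped m W) z v w) = fderiv ℝ (dTheta m) z v w
      + chMetric m (proj m z) (Complex.I • proj m v) (proj m w)
      + ((radial m z)⁻¹ + deriv W (radial m z) * (W (radial m z))⁻¹)
        * (du m z v * dTheta m z w + du m z w * dTheta m z v) := by
  have hr := radial_pos m z hz.1
  have h := apply_christoffel (isInvertible_warped hz hW0) v w (ddTheta m z)
  rw [warped_apply] at h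
  simp only [fderiv_warped hz hW hW0, proj_ddTheta, dTheta_ddTheta m z hz, du_ddTheta hz.1,
    map_zero, chGamma_zero_left, chGamma_zero_right, zero_apply] at h
  rw [fderiv_du_symm hz.1 (ddTheta m z) v, fderiv_du_symm hz.1 (ddTheta m z) w,
    fderiv_dTheta_sub hz (ddTheta m z) v, fderiv_dTheta_sub hz (ddTheta m z) w,
    fderiv_dTheta_sub hz w v, proj_ddTheta] at h
  rw [chMetric_I_swap _ (proj m w)] at h
  simp only [smul_zero, map_zero, zero_apply] at h
  generalize W (radial m z) = W₀ at *
  generalize radial m z = u at *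
  have e : u ^ 2 * W₀ ^ 2 ≠ 0 := by positivity
  apply mul_left_cancel₀ e
  have e' : ∀ A B : ℝ, u ^ 2 * W₀ ^ 2 * (A + (u⁻¹ + deriv W u * W₀⁻¹) * B)
      = u ^ 2 * W₀ ^ 2 * A + u * W₀ * (W₀ + u * deriv W u) * B := by
    intro A B; field_simp
  rw [e']
  linear_combination h

theorem du_christoffel (hz : z ∈ punctured m)
    (hW : ContDiffAt ℝ ∞ W (radial m z)) (hW0 : 0 < W (radial m z)) (v w : Cvec (m + 1)) :
    du m z (christoffel (warped m W) z v w) = fderiv ℝ (du m) z v w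
      - radial m z * W (radial m z) ^ 2 * chMetric m (proj m z) (proj m v) (proj m w)
      - radial m z * W (radial m z) ^ 3 * (W (radial m z) + radial m z * deriv W (radial m z))
        * (dTheta m z v * dTheta m z w)
      - deriv W (radial m z) * (W (radial m z))⁻¹ * (du m z v * du m z w) := by
  have hr := radial_pos m z hz.1
  have h := apply_christoffel (isInvertible_warped hz hW0) v w (ddU m z)
  rw [warped_apply] at h
  simp only [fderiv_warped hz hW hW0, proj_ddU, dTheta_ddU m z hz, du_ddU m z hz,
    map_zero, chGamma_zero_left, chGamma_zero_right, zero_apply] at h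
  rw [fderiv_du_symm hz.1 (ddU m z) v, fderiv_du_symm hz.1 (ddU m z) w, fderiv_du_symm hz.1 w v,
    fderiv_dTheta_sub hz (ddU m z) v, fderiv_dTheta_sub hz (ddU m z) w, proj_ddU] at h
  simp only [smul_zero, map_zero, zero_apply] at h
  generalize W (radial m z) = W₀ at *
  generalize radial m z = u at *
  have e : (W₀ ^ 2)⁻¹ ≠ 0 := by positivity
  apply mul_left_cancel₀ e
  field_simp at h ⊢
  linarith

/-- Koszul's formula is tested against an arbitrary `y`. The vertical components being known, only
the base metric part remains unknown, and nondegeneracy on the base determines it. The terms with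
`I` come from `d(dθ)`. -/
theorem proj_christoffel (hz : z ∈ punctured m)
    (hW : ContDiffAt ℝ ∞ W (radial m z)) (hW0 : 0 < W (radial m z)) (v w : Cvec (m + 1)) :
    proj m (christoffel (warped m W) z v w) = chGamma (proj m z) (proj m v) (proj m w)
      + (radial m z)⁻¹ • (du m z v • proj m w + du m z w • proj m v)
      - (W (radial m z) ^ 2) • (dTheta m z w • (Complex.I • proj m v)
        + dTheta m z v • (Complex.I • proj m w)) := by
  have hr := radial_pos m z hz.1
  refine eq_of_chMetric_eq (punctured_pos m z hz.1).2.2 fun y => ?_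
  obtain ⟨y, rfl⟩ := proj_surjective m y
  have h := apply_christoffel (isInvertible_warped hz hW0) v w y
  rw [warped_apply, dTheta_christoffel hz hW hW0, du_christoffel hz hW hW0] at h
  simp only [fderiv_warped hz hW hW0] at h
  rw [fderiv_du_symm hz.1 y v, fderiv_du_symm hz.1 y w, fderiv_du_symm hz.1 w v,
    fderiv_dTheta_sub hz y v, fderiv_dTheta_sub hz y w, fderiv_dTheta_sub hz w v,
    chGamma_symm _ (proj m w) (proj m v), chGamma_symm _ (proj m y) (proj m v),
    chGamma_symm _ (proj m y) (proj m w), chMetric_I_swap _ (proj m w) (proj m v),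
    chMetric_I_swap _ (proj m y) (proj m v), chMetric_I_swap _ (proj m y) (proj m w),
    chMetric_symm _ (proj m v) (chGamma _ _ _),
    chMetric_symm _ (proj m w) (chGamma _ _ _)] at h
  simp only [map_add, map_sub, map_smul, add_apply, sub_apply, smul_apply, smul_eq_mul]
  generalize W (radial m z) = W₀ at *
  generalize radial m z = u at *
  have e : 2 * u * W₀ ^ 3 ≠ 0 := by positivity
  field_simp at h ⊢
  apply mul_left_cancel₀ e
  linear_combination h

end Components

/-! ### Derivatives of the connection components. -/

section Curvature

open Filter Topology

variable {W : ℝ → ℝ} {z : Cvec (m + 1)}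

/-- The conditions on a point under which `warped m W` is a smooth metric near it. -/
def IsRegular (m : ℕ) (W : ℝ → ℝ) (z : Cvec (m + 1)) : Prop :=
  z ∈ punctured m ∧ ContDiffAt ℝ ∞ W (radial m z) ∧ 0 < W (radial m z)

/-- The component formulas for `christoffel` hold at regular points only. Since regularity persists
along short segments, both sides of these formulas may be differentiated. -/
theorem eventually_isRegular_line {I : Set ℝ} (hI : IsOpen I)
    (hW : ContDiffOn ℝ ∞ W I) (hWpos : ∀ t ∈ I, 0 < W t) (hz : z ∈ punctured m)
    (hzI : radial m z ∈ I) (b : Cvec (m + 1)) :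
    ∀ᶠ t : ℝ in 𝓝 0, IsRegular m W (z + t • b) := by
  have hc : Tendsto (fun t : ℝ => z + t • b) (𝓝 0) (𝓝 z) := by
    have := (hasDerivAt_line z b).continuousAt.tendsto
    simpa using this
  have h1 := hc.eventually ((isOpen_punctured m).mem_nhds hz)
  have h2 := hc.eventually ((contDiffAt_radial hz.1).continuousAt.eventually
    (hI.mem_nhds hzI))
  filter_upwards [h1, h2] with t ht1 ht2
  exact ⟨ht1, hW.contDiffAt (hI.mem_nhds ht2), hWpos _ ht2⟩

theorem IsRegular.contDiffAt_christoffel (h : IsRegular m W z) (a c : Cvec (m + 1)) :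
    ContDiffAt ℝ ∞ (fun y => christoffel (warped m W) y a c) z :=
  CHWarp.contDiffAt_christoffel (isInvertible_warped h.1 h.2.2) (contDiffAt_warped h.1 h.2.1 h.2.2)
    a c

theorem IsRegular.hasDerivAt_christoffel_line (h : IsRegular m W z) (a b c : Cvec (m + 1)) :
    HasDerivAt (fun t : ℝ => christoffel (warped m W) (z + t • b) a c)
      (fderiv ℝ (fun y => christoffel (warped m W) y a c) z b) 0 :=
  hasDerivAt_comp_line ((h.contDiffAt_christoffel a c).differentiableAt (by simp)) b

theorem IsRegular.hasDerivAt_W_line (h : IsRegular m W z) (b : Cvec (m + 1)) :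
    HasDerivAt (fun t : ℝ => W (radial m (z + t • b))) (deriv W (radial m z) * du m z b) 0 :=
  hasDerivAt_comp_radial_line h.1.1 (h.2.1.differentiableAt (by simp)).hasDerivAt b

theorem IsRegular.hasDerivAt_deriv_W_line (h : IsRegular m W z) (b : Cvec (m + 1)) :
    HasDerivAt (fun t : ℝ => deriv W (radial m (z + t • b)))
      (deriv (deriv W) (radial m z) * du m z b) 0 := by
  refine hasDerivAt_comp_radial_line h.1.1 (DifferentiableAt.hasDerivAt ?_) b
  have h' := (contDiffAt_fderiv h.2.1).clm_apply (contDiffAt_const (c := (1 : ℝ)))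
  exact h'.differentiableAt (by simp)

theorem IsRegular.hasDerivAt_inv_radial_line (h : IsRegular m W z) (b : Cvec (m + 1)) :
    HasDerivAt (fun t : ℝ => (radial m (z + t • b))⁻¹)
      (-((radial m z)⁻¹ ^ 2 * du m z b)) 0 := by
  have hr := radial_pos m z h.1.1
  refine ((hasDerivAt_radial_line h.1.1 b).fun_inv (by simpa using hr.ne')).congr_deriv ?_
  rw [zero_smul, add_zero]
  field_simp

theorem IsRegular.hasDerivAt_inv_W_line (h : IsRegular m W z) (b : Cvec (m + 1)) :
    HasDerivAt (fun t : ℝ => (W (radial m (z + t • b)))⁻¹)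
      (-(deriv W (radial m z) * (W (radial m z))⁻¹ ^ 2 * du m z b)) 0 := by
  refine ((h.hasDerivAt_W_line b).fun_inv (by simpa using h.2.2.ne')).congr_deriv ?_
  rw [zero_smul, add_zero]
  have := h.2.2.ne'
  field_simp

theorem hasDerivAt_chGamma_proj_line (hz : ‖z‖ < 1) (b : Cvec (m + 1)) (a c : Cvec m) :
    HasDerivAt (fun t : ℝ => chGamma (proj m (z + t • b)) a c)
      (chGammaDeriv (proj m z) (proj m b) a c) 0 := by
  simp only [proj_line]
  exact hasDerivAt_chGamma_line (punctured_pos m z hz).2.2 a c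

theorem proj_fderiv_christoffel (hz : IsRegular m W z) (a b c : Cvec (m + 1))
    (hev : ∀ᶠ t : ℝ in 𝓝 0, IsRegular m W (z + t • b)) :
    proj m (fderiv ℝ (fun y => christoffel (warped m W) y a c) z b)
      = chGammaDeriv (proj m z) (proj m b) (proj m a) (proj m c)
        - ((radial m z)⁻¹ ^ 2 * du m z b) • (du m z a • proj m c + du m z c • proj m a)
        + (radial m z)⁻¹ • (fderiv ℝ (du m) z b a • proj m c + fderiv ℝ (du m) z b c • proj m a)
        - (2 * W (radial m z) * deriv W (radial m z) * du m z b) •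
          (dTheta m z c • (Complex.I • proj m a) + dTheta m z a • (Complex.I • proj m c))
        - (W (radial m z) ^ 2) • (fderiv ℝ (dTheta m) z b c • (Complex.I • proj m a)
          + fderiv ℝ (dTheta m) z b a • (Complex.I • proj m c)) := by
  have h1 := (proj m).hasFDerivAt.comp_hasDerivAt (0 : ℝ) (hz.hasDerivAt_christoffel_line a b c)
  have h2 := ((hasDerivAt_chGamma_proj_line hz.1.1 b (proj m a) (proj m c)).fun_add
    ((hz.hasDerivAt_inv_radial_line b).fun_smul
      (((hasDerivAt_du_line hz.1.1 b a).smul_const (proj m c)).fun_add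
        ((hasDerivAt_du_line hz.1.1 b c).smul_const (proj m a))))).fun_sub
    (((hz.hasDerivAt_W_line b).fun_pow 2).fun_smul
      (((hasDerivAt_dTheta_line' hz.1 b c).smul_const (Complex.I • proj m a)).fun_add
        ((hasDerivAt_dTheta_line' hz.1 b a).smul_const (Complex.I • proj m c))))
  have h3 := h1.congr_of_eventuallyEq (f₁ := _) (hev.mono fun t ht =>
    (proj_christoffel ht.1 ht.2.1 ht.2.2 a c).symm)
  rw [h3.unique h2]
  simp only [zero_smul, add_zero]
  module

/-- Unlike `proj`, the form `dθ` varies with the point, so the Leibniz rule leaves the last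
correction term. The same happens for `du`. -/
theorem dTheta_fderiv_christoffel (hz : IsRegular m W z) (a b c : Cvec (m + 1))
    (hev : ∀ᶠ t : ℝ in 𝓝 0, IsRegular m W (z + t • b)) :
    dTheta m z (fderiv ℝ (fun y => christoffel (warped m W) y a c) z b)
      = fderiv ℝ (fderiv ℝ (dTheta m)) z b a c
        + (chMetric m (proj m z) (chGamma (proj m z) (proj m b) (Complex.I • proj m a)) (proj m c)
          + chMetric m (proj m z) (Complex.I • proj m a) (chGamma (proj m z) (proj m b) (proj m c)))
        + (deriv (deriv W) (radial m z) * (W (radial m z))⁻¹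
            - deriv W (radial m z) ^ 2 * (W (radial m z))⁻¹ ^ 2 - (radial m z)⁻¹ ^ 2) * du m z b
          * (du m z a * dTheta m z c + du m z c * dTheta m z a)
        + ((radial m z)⁻¹ + deriv W (radial m z) * (W (radial m z))⁻¹)
          * (fderiv ℝ (du m) z b a * dTheta m z c + du m z a * fderiv ℝ (dTheta m) z b c
            + fderiv ℝ (du m) z b c * dTheta m z a + du m z c * fderiv ℝ (dTheta m) z b a)
        - fderiv ℝ (dTheta m) z b (christoffel (warped m W) z a c) := by
  have h1 := (hasDerivAt_comp_line ((contDiffAt_dTheta hz.1).differentiableAt (by simp)) b).clm_apply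
    (hz.hasDerivAt_christoffel_line a b c)
  have hS : HasDerivAt (fun t : ℝ => fderiv ℝ (dTheta m) (z + t • b) a c)
      (fderiv ℝ (fderiv ℝ (dTheta m)) z b a c) 0 :=
    (ContinuousLinearMap.apply ℝ ℝ c).hasFDerivAt.comp_hasDerivAt (0 : ℝ)
      (hasDerivAt_clm_apply_line
        ((contDiffAt_fderiv (contDiffAt_dTheta hz.1)).differentiableAt (by simp)) b a)
  have h2 := (hS.fun_add (hasDerivAt_base_line hz.1.1 b (Complex.I • proj m a) (proj m c))).fun_add
    (((hz.hasDerivAt_inv_radial_line b).fun_add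
      ((hz.hasDerivAt_deriv_W_line b).fun_mul (hz.hasDerivAt_inv_W_line b))).fun_mul
      (((hasDerivAt_du_line hz.1.1 b a).fun_mul (hasDerivAt_dTheta_line' hz.1 b c)).fun_add
        ((hasDerivAt_du_line hz.1.1 b c).fun_mul (hasDerivAt_dTheta_line' hz.1 b a))))
  have h3 := h1.congr_of_eventuallyEq (f₁ := _) (hev.mono fun t ht =>
    (dTheta_christoffel ht.1 ht.2.1 ht.2.2 a c).symm)
  have h4 := h3.unique h2
  simp only [zero_smul, add_zero] at h4
  linear_combination h4

/-- The long coefficient of `dθ ⊗ dθ` is the `u`-derivative of `u W³ (W + u W')`. -/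
theorem du_fderiv_christoffel (hz : IsRegular m W z) (a b c : Cvec (m + 1))
    (hev : ∀ᶠ t : ℝ in 𝓝 0, IsRegular m W (z + t • b)) :
    du m z (fderiv ℝ (fun y => christoffel (warped m W) y a c) z b)
      = fderiv ℝ (fderiv ℝ (du m)) z b a c
        - (W (radial m z) ^ 2 + 2 * radial m z * W (radial m z) * deriv W (radial m z)) * du m z b
          * chMetric m (proj m z) (proj m a) (proj m c)
        - radial m z * W (radial m z) ^ 2 *
          (chMetric m (proj m z) (chGamma (proj m z) (proj m b) (proj m a)) (proj m c)
            + chMetric m (proj m z) (proj m a) (chGamma (proj m z) (proj m b) (proj m c)))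
        - (W (radial m z) ^ 4 + 6 * radial m z * W (radial m z) ^ 3 * deriv W (radial m z)
            + 3 * radial m z ^ 2 * W (radial m z) ^ 2 * deriv W (radial m z) ^ 2
            + radial m z ^ 2 * W (radial m z) ^ 3 * deriv (deriv W) (radial m z)) * du m z b
          * (dTheta m z a * dTheta m z c)
        - radial m z * W (radial m z) ^ 3 * (W (radial m z) + radial m z * deriv W (radial m z))
          * (fderiv ℝ (dTheta m) z b a * dTheta m z c + dTheta m z a * fderiv ℝ (dTheta m) z b c)
        - (deriv (deriv W) (radial m z) * (W (radial m z))⁻¹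
            - deriv W (radial m z) ^ 2 * (W (radial m z))⁻¹ ^ 2) * du m z b
          * (du m z a * du m z c)
        - deriv W (radial m z) * (W (radial m z))⁻¹
          * (fderiv ℝ (du m) z b a * du m z c + du m z a * fderiv ℝ (du m) z b c)
        - fderiv ℝ (du m) z b (christoffel (warped m W) z a c) := by
  have h1 := (hasDerivAt_comp_line ((contDiffAt_du hz.1.1).differentiableAt (by simp)) b).clm_apply
    (hz.hasDerivAt_christoffel_line a b c)
  have hS : HasDerivAt (fun t : ℝ => fderiv ℝ (du m) (z + t • b) a c)
      (fderiv ℝ (fderiv ℝ (du m)) z b a c) 0 :=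
    (ContinuousLinearMap.apply ℝ ℝ c).hasFDerivAt.comp_hasDerivAt (0 : ℝ)
      (hasDerivAt_clm_apply_line
        ((contDiffAt_fderiv (contDiffAt_du hz.1.1)).differentiableAt (by simp)) b a)
  have hu := hasDerivAt_radial_line hz.1.1 b
  have hw := hz.hasDerivAt_W_line b
  have hw' := hz.hasDerivAt_deriv_W_line b
  have h2 := ((hS.fun_sub ((hu.fun_mul (hw.fun_pow 2)).fun_mul
    (hasDerivAt_base_line hz.1.1 b (proj m a) (proj m c)))).fun_sub
    (((hu.fun_mul (hw.fun_pow 3)).fun_mul (hw.fun_add (hu.fun_mul hw'))).fun_mul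
      ((hasDerivAt_dTheta_line' hz.1 b a).fun_mul (hasDerivAt_dTheta_line' hz.1 b c)))).fun_sub
    ((hw'.fun_mul (hz.hasDerivAt_inv_W_line b)).fun_mul
      ((hasDerivAt_du_line hz.1.1 b a).fun_mul (hasDerivAt_du_line hz.1.1 b c)))
  have h3 := h1.congr_of_eventuallyEq (f₁ := _) (hev.mono fun t ht =>
    (du_christoffel ht.1 ht.2.1 ht.2.2 a c).symm)
  have h4 := h3.unique h2
  simp only [zero_smul, add_zero] at h4
  norm_num at h4
  linear_combination h4

end Curvature

/-! ### The curvature of the warped metric in components. -/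

theorem chGamma_sub_right {k : ℕ} (w v z z' : Cvec k) :
    chGamma w v (z - z') = chGamma w v z - chGamma w v z' := by
  simp only [chGamma, inner_sub_right]; module

theorem chHerm_im_swap {k : ℕ} (w v z : Cvec k) : (chHerm w v z).im = -(chHerm w z v).im := by
  rw [← chHerm_conj, Complex.conj_im]

theorem I_smul_I_smul {k : ℕ} (v : Cvec k) : Complex.I • (Complex.I • v) = -v := by
  rw [smul_smul, Complex.I_mul_I, neg_one_smul]

section Curvature

open Filter Topology

variable {W : ℝ → ℝ} {z : Cvec (m + 1)}

/-- After antisymmetrization in `a` and `b`, the base curvature enters with factor `1`. The `W²`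
multiple of the same tensor arises from the products of connection terms together with `d(dθ)`. -/
theorem proj_curvature (hz : IsRegular m W z) (a b c : Cvec (m + 1))
    (hev : ∀ b, ∀ᶠ t : ℝ in 𝓝 0, IsRegular m W (z + t • b)) :
    proj m (curvatureField (warped m W) (fun _ => a) (fun _ => b) (fun _ => c) z)
      = (1 + W (radial m z) ^ 2) •
          (chMetric m (proj m z) (proj m b) (proj m c) • proj m a
            - chMetric m (proj m z) (proj m a) (proj m c) • proj m b
            + chMetric m (proj m z) (Complex.I • proj m b) (proj m c) • (Complex.I • proj m a)
            - chMetric m (proj m z) (Complex.I • proj m a) (proj m c) • (Complex.I • proj m b)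
            - (2 * chMetric m (proj m z) (Complex.I • proj m a) (proj m b)) •
              (Complex.I • proj m c))
        + (deriv W (radial m z) * (W (radial m z))⁻¹ * (radial m z)⁻¹) •
          ((du m z b * du m z c) • proj m a - (du m z a * du m z c) • proj m b)
        + (radial m z * W (radial m z) ^ 3 * deriv W (radial m z)) •
          ((dTheta m z b * dTheta m z c) • proj m a - (dTheta m z a * dTheta m z c) • proj m b)
        - (W (radial m z) * deriv W (radial m z)) •
          ((du m z b * dTheta m z c - dTheta m z b * du m z c) • (Complex.I • proj m a)
            - (du m z a * dTheta m z c - dTheta m z a * du m z c) • (Complex.I • proj m b)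
            + (2 * (du m z b * dTheta m z a - dTheta m z b * du m z a)) •
              (Complex.I • proj m c)) := by
  obtain ⟨h1, h2, h3⟩ := id hz
  have hr := radial_pos m z h1.1
  have hcurv := chGamma_curvature (proj m z) (proj m a) (proj m b) (proj m c)
  rw [curvatureField_const]
  simp only [map_sub, map_add, proj_fderiv_christoffel hz _ _ _ (hev _), proj_christoffel h1 h2 h3,
    dTheta_christoffel h1 h2 h3, du_christoffel h1 h2 h3]
  rw [fderiv_du_symm h1.1 b a, fderiv_dTheta_sub h1 b a,
    chMetric_I_swap _ (proj m b) (proj m a)]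
  simp only [chGamma_add_right, chGamma_sub_right, chGamma_real_smul_right, chGamma_smul_right,
    smul_add, smul_sub, smul_comm Complex.I (_ : ℝ), I_smul_I_smul] at hcurv ⊢
  rw [chGamma_symm _ (proj m b) (proj m a)]
  generalize Complex.I • proj m a = Ia at *
  generalize Complex.I • proj m b = Ib at *
  generalize Complex.I • proj m c = Ic at *
  -- Subtracting the base curvature leaves a linear identity among the remaining vectors, checked
  -- coefficient by coefficient. The coefficients are complex because `chGamma` is complex linear,
  -- hence the casts below.
  linear_combination (norm := skip) (1 : ℝ) • hcurv
  generalize W (radial m z) = W₀ at *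
  generalize radial m z = u at *
  have hW' : (W₀ : ℂ) ≠ 0 := by exact_mod_cast h3.ne'
  have hu' : (u : ℂ) ≠ 0 := by exact_mod_cast hr.ne'
  match_scalars <;> push_cast [Complex.coe_algebraMap] <;> field_simp <;> ring

/-- Second derivatives of `dθ` cancel by symmetry in `a` and `b`. The base connection terms cancel
as well, because `chGamma` is symmetric and commutes with `I`: the Kähler form is parallel. -/
theorem dTheta_curvature (hz : IsRegular m W z) (a b c : Cvec (m + 1))
    (hev : ∀ b, ∀ᶠ t : ℝ in 𝓝 0, IsRegular m W (z + t • b)) :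
    dTheta m z (curvatureField (warped m W) (fun _ => a) (fun _ => b) (fun _ => c) z)
      = radial m z * W (radial m z) * deriv W (radial m z) *
          (dTheta m z a * chMetric m (proj m z) (proj m b) (proj m c)
            - dTheta m z b * chMetric m (proj m z) (proj m a) (proj m c))
        - deriv W (radial m z) * (W (radial m z))⁻¹ *
          (du m z a * chMetric m (proj m z) (Complex.I • proj m b) (proj m c)
            - du m z b * chMetric m (proj m z) (Complex.I • proj m a) (proj m c)
            - 2 * du m z c * chMetric m (proj m z) (Complex.I • proj m a) (proj m b))
        + (3 * deriv W (radial m z) * (W (radial m z))⁻¹ * (radial m z)⁻¹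
            + deriv (deriv W) (radial m z) * (W (radial m z))⁻¹
            + deriv W (radial m z) ^ 2 * (W (radial m z))⁻¹ ^ 2) *
          (dTheta m z a * du m z b - du m z a * dTheta m z b) * du m z c := by
  obtain ⟨h1, h2, h3⟩ := id hz
  have hr := radial_pos m z h1.1
  rw [curvatureField_const]
  simp only [map_sub, map_add, dTheta_fderiv_christoffel hz _ _ _ (hev _), proj_christoffel h1 h2 h3,
    dTheta_christoffel h1 h2 h3, du_christoffel h1 h2 h3]
  rw [fderiv_du_symm h1.1 b a, fderiv_dTheta_sub h1 b a,
    fderiv_fderiv_symm (contDiffAt_dTheta h1) b a]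
  simp only [chGamma_smul_right, smul_add, map_add, map_smul, smul_eq_mul, chMetric_I_I]
  rw [chGamma_symm _ (proj m b) (proj m a), chMetric_I_swap _ (proj m b) (proj m a),
    chMetric_symm _ (proj m b) (proj m a)]
  generalize W (radial m z) = W₀ at *
  generalize radial m z = u at *
  field_simp
  ring

theorem du_curvature (hz : IsRegular m W z) (a b c : Cvec (m + 1))
    (hev : ∀ b, ∀ᶠ t : ℝ in 𝓝 0, IsRegular m W (z + t • b)) :
    du m z (curvatureField (warped m W) (fun _ => a) (fun _ => b) (fun _ => c) z)
      = radial m z * W (radial m z) * deriv W (radial m z) *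
          (du m z a * chMetric m (proj m z) (proj m b) (proj m c)
            - du m z b * chMetric m (proj m z) (proj m a) (proj m c))
        + radial m z ^ 2 * W (radial m z) ^ 3 * deriv W (radial m z) *
          (dTheta m z a * chMetric m (proj m z) (Complex.I • proj m b) (proj m c)
            - dTheta m z b * chMetric m (proj m z) (Complex.I • proj m a) (proj m c)
            - 2 * dTheta m z c * chMetric m (proj m z) (Complex.I • proj m a) (proj m b))
        - radial m z ^ 2 * W (radial m z) ^ 2 *
          (3 * W (radial m z) * deriv W (radial m z) * (radial m z)⁻¹
            + W (radial m z) * deriv (deriv W) (radial m z) + deriv W (radial m z) ^ 2) *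
          (dTheta m z a * du m z b - du m z a * dTheta m z b) * dTheta m z c := by
  obtain ⟨h1, h2, h3⟩ := id hz
  have hr := radial_pos m z h1.1
  rw [curvatureField_const]
  simp only [map_sub, map_add, du_fderiv_christoffel hz _ _ _ (hev _), proj_christoffel h1 h2 h3,
    dTheta_christoffel h1 h2 h3, du_christoffel h1 h2 h3]
  rw [fderiv_du_symm h1.1 b a, fderiv_dTheta_sub h1 b a,
    fderiv_fderiv_symm (f := du m) (contDiffAt_du h1.1) b a]
  simp only [map_add, map_smul, smul_eq_mul]
  rw [chGamma_symm _ (proj m b) (proj m a), chMetric_I_swap _ (proj m b) (proj m a),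
    chMetric_symm _ (proj m b) (proj m a)]
  simp only [chMetric_I_right, chMetric_I_left]
  rw [chHerm_im_swap _ (proj m b) (proj m a)]
  generalize W (radial m z) = W₀ at *
  generalize radial m z = u at *
  field_simp
  ring

end Curvature

/-! ### The full curvature tensor. -/

section Riemann

open Filter Topology

variable {W : ℝ → ℝ} {z : Cvec (m + 1)}

/-- Pairing with `d` needs only the three components of the curvature. The symbols `h`, `Ω`, `θ`,
`μ` abbreviate the base metric, the Kähler form, `dθ` and `du`; `τ` is `du ∧ dθ`, proportional to
the area form of the fibre. -/
theorem riemann_warped (hz : IsRegular m W z) (a b c d : Cvec (m + 1))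
    (hev : ∀ b, ∀ᶠ t : ℝ in 𝓝 0, IsRegular m W (z + t • b)) {u W₀ W₁ W₂ : ℝ}
    (hu : u = radial m z) (hW₀ : W₀ = W u) (hW₁ : W₁ = deriv W u) (hW₂ : W₂ = deriv (deriv W) u)
    {h Ω τ : Cvec (m + 1) → Cvec (m + 1) → ℝ} {θ μ : Cvec (m + 1) → ℝ}
    (hh : ∀ v w, chMetric m (proj m z) (proj m v) (proj m w) = h v w)
    (hΩ : ∀ v w, chMetric m (proj m z) (Complex.I • proj m v) (proj m w) = Ω v w)
    (hθ : ∀ v, dTheta m z v = θ v) (hμ : ∀ v, du m z v = μ v)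
    (hτ : ∀ v w, τ v w = μ v * θ w - θ v * μ w) :
    riemann (warped m W) z a b c d =
      u ^ 2 * (1 + W₀ ^ 2) *
        (h b c * h a d + Ω b c * Ω a d - h a c * h b d - Ω a c * Ω b d - 2 * Ω a b * Ω c d)
      + u * W₁ * W₀⁻¹ * (μ b * μ c * h a d - μ a * μ c * h b d - μ b * μ d * h a c
          + μ a * μ d * h b c)
      + u ^ 3 * W₀ ^ 3 * W₁ * (θ b * θ c * h a d - θ a * θ c * h b d - θ b * θ d * h a c
          + θ a * θ d * h b c)
      - u ^ 2 * W₀ * W₁ * (τ b c * Ω a d - τ a c * Ω b d + 2 * τ b a * Ω c d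
          + τ a d * Ω b c - τ b d * Ω a c + 2 * τ d c * Ω a b)
      - u ^ 2 * (3 * (W₀ * W₁ / u) + (W₀ * W₂ + W₁ ^ 2)) * (τ a b * τ c d) := by
  have hr := radial_pos m z hz.1.1
  have hw := hz.2.2
  rw [riemann, warped_apply, proj_curvature hz a b c hev, dTheta_curvature hz a b c hev,
    du_curvature hz a b c hev]
  rw [← hu] at *
  rw [← hW₀] at *
  rw [← hW₁, ← hW₂]
  simp only [map_add, map_sub, map_smul, add_apply, sub_apply, smul_apply, smul_eq_mul, hh, hΩ, hθ,
    hμ, hτ]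
  field_simp
  ring

end Riemann

/-- Orthogonality to the radial field `euler` is the vanishing of `du`, just as orthogonality to
`ddTheta` gives that of `dθ`. -/
theorem du_horizontal {z v : Cvec (m + 1)} (hz : z ∈ punctured m)
    (hv : IsHorizontal m z v) : du m z v = 0 := by
  obtain ⟨h1, h2, h3⟩ := punctured_pos m z hz.1
  have hn : 0 < Complex.normSq (z (Fin.last m)) := Complex.normSq_pos.2 hz.2
  have h := hv (euler m z) (by rw [euler, proj_single])
  rw [chMetric_apply, inner_eq m v, inner_eq m z v, inner_eq m z, euler, proj_single] at h
  rw [du_apply m z v hz.1, inner_eq m z v]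
  simp only [PiLp.single_apply, if_true] at h
  rw [h2] at h ⊢
  have h4 : 1 - ‖proj m z‖ ^ 2 - Complex.normSq (z (Fin.last m)) ≠ 0 := by rw [← h2]; exact h1.ne'
  generalize radial m z = u at *
  generalize inner ℂ (proj m z) (proj m v) = a at *
  generalize z (Fin.last m) = ζ at *
  generalize v (Fin.last m) = ν at *
  generalize 1 - ‖proj m z‖ ^ 2 = S at *
  obtain ⟨a₁, a₂⟩ := a
  obtain ⟨x, y⟩ := ζ
  obtain ⟨p, q⟩ := ν
  simp [Complex.normSq_apply] at hn h4 h ⊢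
  have hD : S - (x ^ 2 + y ^ 2) ≠ 0 := by rwa [sq, sq]
  refine Or.inl (Or.inr ?_)
  field_simp at h
  linear_combination h

/-! ### The components in the frame -/

/-- The metric on the horizontal part of the frame. -/
def frameDelta (m a b : ℕ) : ℝ := if a = b ∧ a ≤ 2 * m then 1 else 0

/-- The Kähler form on the horizontal part of the frame. -/
def frameOmega (m a b : ℕ) : ℝ :=
  if Odd a ∧ a ≤ 2 * m ∧ b = a + 1 then 1 else
    if Odd b ∧ b ≤ 2 * m ∧ a = b + 1 then -1 else 0

/-- The area form on the vertical part of the frame. -/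
def frameTau (m a b : ℕ) : ℝ :=
  (if a = 2 * m + 2 then 1 else 0) * (if b = 2 * m + 1 then 1 else 0)
    - (if a = 2 * m + 1 then 1 else 0) * (if b = 2 * m + 2 then 1 else 0)

/-- The metric on the vertical part of the frame. -/
def frameVert (m a b : ℕ) : ℝ := if a = b ∧ 2 * m < a then 1 else 0

/-- The curvature components as a function of the three sectional curvatures. -/
def frameCurvature (m : ℕ) (α β γ : ℝ) (a b c d : ℕ) : ℝ :=
  α * (frameDelta m b c * frameDelta m a d + frameOmega m b c * frameOmega m a d
      - frameDelta m a c * frameDelta m b d - frameOmega m a c * frameOmega m b d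
      - 2 * (frameOmega m a b * frameOmega m c d))
    + β * (frameVert m b c * frameDelta m a d - frameVert m a c * frameDelta m b d
      - frameVert m b d * frameDelta m a c + frameVert m a d * frameDelta m b c)
    - β * (frameTau m b c * frameOmega m a d - frameTau m a c * frameOmega m b d
      + 2 * (frameTau m b a * frameOmega m c d) + frameTau m a d * frameOmega m b c
      - frameTau m b d * frameOmega m a c + 2 * (frameTau m d c * frameOmega m a b))
    - γ * (frameTau m a b * frameTau m c d)

theorem frameDelta_comm (m a b : ℕ) : frameDelta m a b = frameDelta m b a := by
  unfold frameDelta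
  congr 1
  grind

theorem frameVert_comm (m a b : ℕ) : frameVert m a b = frameVert m b a := by
  unfold frameVert
  congr 1
  grind

theorem frameOmega_swap (m a b : ℕ) : frameOmega m a b = -frameOmega m b a := by
  unfold frameOmega
  grind

theorem frameTau_swap (m a b : ℕ) : frameTau m a b = -frameTau m b a := by
  unfold frameTau
  ring

/-- The symmetries of the components are read off the explicit formula, from the symmetry of
`frameDelta`, `frameVert` and the antisymmetry of `frameOmega`, `frameTau`. -/
theorem frameCurvature_swap_left (m : ℕ) (α β γ : ℝ) (a b c d : ℕ) :
    frameCurvature m α β γ b a c d = -frameCurvature m α β γ a b c d := by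
  unfold frameCurvature
  rw [frameOmega_swap m b a, frameTau_swap m b a]
  ring

theorem frameCurvature_swap_right (m : ℕ) (α β γ : ℝ) (a b c d : ℕ) :
    frameCurvature m α β γ a b d c = -frameCurvature m α β γ a b c d := by
  unfold frameCurvature
  rw [frameOmega_swap m d c, frameTau_swap m d c]
  ring

theorem frameCurvature_swap_pairs (m : ℕ) (α β γ : ℝ) (a b c d : ℕ) :
    frameCurvature m α β γ c d a b = frameCurvature m α β γ a b c d := by
  unfold frameCurvature
  rw [frameDelta_comm m d a, frameDelta_comm m c b, frameDelta_comm m c a, frameDelta_comm m d b,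
    frameVert_comm m d a, frameVert_comm m c b, frameVert_comm m c a, frameVert_comm m d b,
    frameOmega_swap m d a, frameOmega_swap m c b, frameOmega_swap m c a, frameOmega_swap m d b,
    frameTau_swap m d a, frameTau_swap m c b, frameTau_swap m c a, frameTau_swap m d b,
    frameTau_swap m d c, frameTau_swap m b a]
  ring

/-! ### Nonzero products of frame matrices force listed index patterns. -/

section Vanishing

variable {a b c d : ℕ}

theorem delta_mul_delta_eq_zero (ha : 1 ≤ a) (hb : 1 ≤ b) (hab : a ≠ b)
    (hn : ¬ Listed m a b c d) : frameDelta m a c * frameDelta m b d = 0 := by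
  by_contra h
  simp only [frameDelta, mul_eq_zero, ite_eq_right_iff, one_ne_zero, imp_false, not_or,
    not_not] at h
  obtain ⟨⟨rfl, h1⟩, rfl, h2⟩ := h
  apply hn
  by_cases hp : HolPair a b
  · rcases hp with ⟨ho, rfl⟩ | ⟨ho, rfl⟩
    · exact .hol a (by simp; omega) ho
    · exact .swap_left _ _ _ _ (.swap_right _ _ _ _ (.hol b (by simp; omega) ho))
  · exact .nonhol a b (by simp; omega) (by simp; omega) hab hp

theorem omega_ne_zero (h : frameOmega m a b ≠ 0) :
    (Odd a ∧ a ≤ 2 * m ∧ b = a + 1) ∨ (Odd b ∧ b ≤ 2 * m ∧ a = b + 1) := by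
  unfold frameOmega at h
  grind

theorem mem_of_odd (ho : Odd a) (h : a ≤ 2 * m) : a ∈ Finset.Icc 1 (2 * m) :=
  Finset.mem_Icc.2 ⟨ho.pos, h⟩

/-- Parity: `2 * m` is even, so an odd index in range is at most `2 * m - 1`. -/
theorem succ_mem_of_odd (ho : Odd a) (h : a ≤ 2 * m) : a + 1 ∈ Finset.Icc 1 (2 * m) := by
  obtain ⟨k, rfl⟩ := ho
  simp; omega

/-- Both `{a, c}` and `{b, d}` would be holomorphic pairs. Distinct pairs give the mixed patterns;
coinciding pairs give the holomorphic sectional curvature. -/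
theorem omega_mul_omega_eq_zero (hab : a ≠ b)
    (hn : ¬ Listed m a b c d) : frameOmega m a c * frameOmega m b d = 0 := by
  by_contra h
  obtain ⟨h1, h2⟩ := mul_ne_zero_iff.1 h
  apply hn
  rcases omega_ne_zero h1 with ⟨ho, hl, rfl⟩ | ⟨ho, hl, rfl⟩ <;>
  rcases omega_ne_zero h2 with ⟨ho', hl', rfl⟩ | ⟨ho', hl', rfl⟩
  · exact .mixed₂ a b (mem_of_odd ho hl) (mem_of_odd ho' hl') ho ho' hab
  -- If the pairs coincide, the quadruple is `(a, a + 1, a + 1, a)`.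
  · by_cases e : a = d
    · subst e
      exact .swap_right _ _ _ _ (.hol a (mem_of_odd ho hl) ho)
    · exact .mixed₃ a d (mem_of_odd ho hl) (mem_of_odd ho' hl') ho ho' e
  · apply Listed.swap_pairs
    by_cases e : c = b
    · subst e
      exact .swap_right _ _ _ _ (.hol c (mem_of_odd ho hl) ho)
    · exact .mixed₃ c b (mem_of_odd ho hl) (mem_of_odd ho' hl') ho ho' e
  · exact .swap_pairs _ _ _ _
      (.mixed₂ c d (mem_of_odd ho hl) (mem_of_odd ho' hl') ho ho' (by omega))

theorem omega_mul_omega_eq_zero' (hn : ¬ Listed m a b c d) :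
    frameOmega m a b * frameOmega m c d = 0 := by
  by_contra h
  obtain ⟨h1, h2⟩ := mul_ne_zero_iff.1 h
  have key : ∀ i j : ℕ, Odd i → Odd j → i ≤ 2 * m → j ≤ 2 * m → Listed m i (i + 1) j (j + 1) := by
    intro i j hi hj hi' hj'
    by_cases e : i = j
    · subst e
      exact .hol i (mem_of_odd hi hi') hi
    · exact .mixed₁ i j (mem_of_odd hi hi') (mem_of_odd hj hj') hi hj e
  apply hn
  rcases omega_ne_zero h1 with ⟨ho, hl, rfl⟩ | ⟨ho, hl, rfl⟩ <;>
  rcases omega_ne_zero h2 with ⟨ho', hl', rfl⟩ | ⟨ho', hl', rfl⟩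
  · exact key _ _ ho ho' hl hl'
  · exact .swap_right _ _ _ _ (key _ _ ho ho' hl hl')
  · exact .swap_left _ _ _ _ (key _ _ ho ho' hl hl')
  · exact .swap_left _ _ _ _ (.swap_right _ _ _ _ (key _ _ ho ho' hl hl'))

theorem vert_mul_delta_eq_zero (ha : 1 ≤ a) (hb : b ≤ 2 * m + 2) (hn : ¬ Listed m a b c d) :
    frameVert m b d * frameDelta m a c = 0 := by
  by_contra h
  simp only [frameDelta, frameVert, mul_eq_zero, ite_eq_right_iff, one_ne_zero, imp_false, not_or,
    not_not] at h
  obtain ⟨⟨rfl, h1⟩, rfl, h2⟩ := h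
  apply hn
  obtain rfl | rfl : b = 2 * m + 1 ∨ b = 2 * m + 2 := by omega
  · exact .theta a (by simp; omega)
  · exact .radius a (by simp; omega)

theorem tau_ne_zero (h : frameTau m a b ≠ 0) :
    (a = 2 * m + 2 ∧ b = 2 * m + 1) ∨ (a = 2 * m + 1 ∧ b = 2 * m + 2) := by
  unfold frameTau at h
  grind

theorem tau_mul_omega_eq_zero (hn : ¬ Listed m a b c d) :
    frameTau m b d * frameOmega m a c = 0 := by
  by_contra h
  obtain ⟨h1, h2⟩ := mul_ne_zero_iff.1 h
  apply hn
  rcases tau_ne_zero h1 with ⟨rfl, rfl⟩ | ⟨rfl, rfl⟩ <;>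
  rcases omega_ne_zero h2 with ⟨ho, hl, rfl⟩ | ⟨ho, hl, rfl⟩
  · exact .fibreMixed₃ a (mem_of_odd ho hl) ho
  · exact .swap_pairs _ _ _ _ (.fibreMixed₂ c (mem_of_odd ho hl) ho)
  · exact .fibreMixed₂ a (mem_of_odd ho hl) ho
  · exact .swap_pairs _ _ _ _ (.fibreMixed₃ c (mem_of_odd ho hl) ho)

theorem tau_mul_omega_eq_zero' (hn : ¬ Listed m a b c d) :
    frameTau m d c * frameOmega m a b = 0 := by
  by_contra h
  obtain ⟨h1, h2⟩ := mul_ne_zero_iff.1 h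
  apply hn
  rcases tau_ne_zero h1 with ⟨rfl, rfl⟩ | ⟨rfl, rfl⟩ <;>
  rcases omega_ne_zero h2 with ⟨ho, hl, rfl⟩ | ⟨ho, hl, rfl⟩
  · exact .fibreMixed₁ a (mem_of_odd ho hl) ho
  · exact .swap_left _ _ _ _ (.fibreMixed₁ b (mem_of_odd ho hl) ho)
  · exact .swap_right _ _ _ _ (.fibreMixed₁ a (mem_of_odd ho hl) ho)
  · exact .swap_left _ _ _ _ (.swap_right _ _ _ _ (.fibreMixed₁ b (mem_of_odd ho hl) ho))

theorem tau_mul_tau_eq_zero (hn : ¬ Listed m a b c d) :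
    frameTau m a b * frameTau m c d = 0 := by
  by_contra h
  obtain ⟨h1, h2⟩ := mul_ne_zero_iff.1 h
  apply hn
  rcases tau_ne_zero h1 with ⟨rfl, rfl⟩ | ⟨rfl, rfl⟩ <;>
  rcases tau_ne_zero h2 with ⟨rfl, rfl⟩ | ⟨rfl, rfl⟩
  · exact .swap_left _ _ _ _ (.swap_right _ _ _ _ .fibre)
  · exact .swap_left _ _ _ _ .fibre
  · exact .swap_right _ _ _ _ .fibre
  · exact .fibre

theorem frameCurvature_eq_zero (α β γ : ℝ)
    (ha : a ∈ Finset.Icc 1 (2 * m + 2)) (hb : b ∈ Finset.Icc 1 (2 * m + 2))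
    (hn : ¬ Listed m a b c d) : frameCurvature m α β γ a b c d = 0 := by
  rw [Finset.mem_Icc] at ha hb
  by_cases hab : a = b
  · subst hab
    linarith [frameCurvature_swap_left m α β γ a a c d]
  -- `Listed` is closed under the symmetries, so the permuted quadruples occurring in the formula
  -- are unlisted too.
  have n1 : ¬ Listed m b a c d := fun h => hn (.swap_left _ _ _ _ h)
  have n2 : ¬ Listed m a b d c := fun h => hn (.swap_right _ _ _ _ h)
  have n3 : ¬ Listed m b a d c := fun h => n1 (.swap_right _ _ _ _ h)
  have n4 : ¬ Listed m c d a b := fun h => hn (.swap_pairs _ _ _ _ h)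
  unfold frameCurvature
  rw [delta_mul_delta_eq_zero hb.1 ha.1 (Ne.symm hab) n1, delta_mul_delta_eq_zero ha.1 hb.1 hab hn,
    omega_mul_omega_eq_zero (Ne.symm hab) n1, omega_mul_omega_eq_zero hab hn,
    omega_mul_omega_eq_zero' hn, vert_mul_delta_eq_zero ha.1 hb.2 hn,
    vert_mul_delta_eq_zero ha.1 hb.2 n2, vert_mul_delta_eq_zero hb.1 ha.2 n1,
    vert_mul_delta_eq_zero hb.1 ha.2 n3, tau_mul_omega_eq_zero hn, tau_mul_omega_eq_zero n1,
    tau_mul_omega_eq_zero n2, tau_mul_omega_eq_zero n3, tau_mul_omega_eq_zero' hn,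
    tau_mul_omega_eq_zero' n4, tau_mul_tau_eq_zero hn]
  ring

end Vanishing

/-! ### Evaluation of the metric and the curvature on the frame. -/

section Frame

variable {W : ℝ → ℝ} {z : Cvec (m + 1)} {X : ℕ → Cvec (m + 1)} {a b : ℕ}

theorem frame_of_le (ha : a ≤ 2 * m) : frame m W z X a = (1 / radial m z) • X a := if_pos ha

theorem frame_theta : frame m W z X (2 * m + 1)
    = (1 / (radial m z * W (radial m z))) • ddTheta m z := by
  simp [frame]

theorem frame_radius : frame m W z X (2 * m + 2) = W (radial m z) • ddU m z := by
  simp [frame]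

theorem le_or_eq_or_eq (ha : a ∈ Finset.Icc 1 (2 * m + 2)) :
    a ∈ Finset.Icc 1 (2 * m) ∨ a = 2 * m + 1 ∨ a = 2 * m + 2 := by
  simp only [Finset.mem_Icc] at *
  omega

theorem proj_frame_of_lt (ha : a ∈ Finset.Icc 1 (2 * m + 2)) (h : ¬ a ≤ 2 * m) :
    proj m (frame m W z X a) = 0 := by
  rcases le_or_eq_or_eq ha with h1 | rfl | rfl
  · exact absurd (Finset.mem_Icc.1 h1).2 h
  · rw [frame_theta, map_smul, proj_ddTheta, smul_zero]
  · rw [frame_radius, map_smul, proj_ddU, smul_zero]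

theorem dTheta_frame (hz : z ∈ punctured m) (hX : IsHolomorphicFrame m z X)
    (ha : a ∈ Finset.Icc 1 (2 * m + 2)) :
    dTheta m z (frame m W z X a)
      = (if a = 2 * m + 1 then 1 else 0) / (radial m z * W (radial m z)) := by
  rcases le_or_eq_or_eq ha with h | rfl | rfl
  · have h' := Finset.mem_Icc.1 h
    rw [frame_of_le h'.2, map_smul, dTheta_horizontal m z _ hz (hX.horizontal a h),
      if_neg (by omega)]
    simp
  · rw [frame_theta, map_smul, dTheta_ddTheta m z hz]; simp
  · rw [frame_radius, map_smul, dTheta_ddU m z hz]; simp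

theorem du_frame (hz : z ∈ punctured m) (hX : IsHolomorphicFrame m z X)
    (ha : a ∈ Finset.Icc 1 (2 * m + 2)) :
    du m z (frame m W z X a) = (if a = 2 * m + 2 then 1 else 0) * W (radial m z) := by
  rcases le_or_eq_or_eq ha with h | rfl | rfl
  · have h' := Finset.mem_Icc.1 h
    rw [frame_of_le h'.2, map_smul, du_horizontal hz (hX.horizontal a h), if_neg (by omega)]
    simp
  · rw [frame_theta, map_smul, du_ddTheta hz.1]; simp
  · rw [frame_radius, map_smul, du_ddU m z hz]; simp

theorem chMetric_frame (hX : IsHolomorphicFrame m z X)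
    (ha : a ∈ Finset.Icc 1 (2 * m + 2)) (hb : b ∈ Finset.Icc 1 (2 * m + 2)) :
    chMetric m (proj m z) (proj m (frame m W z X a)) (proj m (frame m W z X b))
      = frameDelta m a b / radial m z ^ 2 := by
  by_cases ha' : a ≤ 2 * m
  · by_cases hb' : b ≤ 2 * m
    · have h := hX.orthonormal a (Finset.mem_Icc.2 ⟨(Finset.mem_Icc.1 ha).1, ha'⟩)
        b (Finset.mem_Icc.2 ⟨(Finset.mem_Icc.1 hb).1, hb'⟩)
      rw [frame_of_le ha', frame_of_le hb', map_smul, map_smul, map_smul, map_smul, smul_apply,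
        smul_eq_mul, smul_eq_mul, h]
      simp only [frameDelta, ha', and_true]
      ring
    · rw [proj_frame_of_lt hb hb', map_zero, frameDelta, if_neg (by omega), zero_div]
  · rw [proj_frame_of_lt ha ha', map_zero, frameDelta, if_neg (by omega), zero_div]
    rfl

theorem chMetric_I_horizontal (hX : IsHolomorphicFrame m z X)
    (ha : a ∈ Finset.Icc 1 (2 * m)) (hb : b ∈ Finset.Icc 1 (2 * m)) :
    chMetric m (proj m z) (Complex.I • proj m (X a)) (proj m (X b)) = frameOmega m a b := by
  have ha' := Finset.mem_Icc.1 ha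
  have hb' := Finset.mem_Icc.1 hb
  rcases Nat.even_or_odd a with he | ho
  -- An even index is the second member of its pair, and `I` sends it to minus the first because `I²
  -- = -1`.
  · obtain ⟨k, rfl⟩ : ∃ k, a = k + 1 := ⟨a - 1, by omega⟩
    have hk : Odd k := by simpa [Nat.even_add_one] using he
    have hkm := mem_of_odd hk (by omega : k ≤ 2 * m)
    rw [hX.holomorphic k hkm hk, I_smul_I_smul, map_neg, neg_apply,
      hX.orthonormal k hkm b hb]
    unfold frameOmega
    grind
  · rw [← hX.holomorphic a ha ho, hX.orthonormal (a + 1) (succ_mem_of_odd ho ha'.2) b hb]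
    unfold frameOmega
    grind

theorem chMetric_I_frame (hX : IsHolomorphicFrame m z X)
    (ha : a ∈ Finset.Icc 1 (2 * m + 2)) (hb : b ∈ Finset.Icc 1 (2 * m + 2)) :
    chMetric m (proj m z) (Complex.I • proj m (frame m W z X a)) (proj m (frame m W z X b))
      = frameOmega m a b / radial m z ^ 2 := by
  -- By parity, no holomorphic pair straddles the horizontal and vertical ranges.
  have h0 : ¬ (a ≤ 2 * m ∧ b ≤ 2 * m) → frameOmega m a b = 0 := by
    intro h
    by_contra hne
    rcases omega_ne_zero hne with ⟨ho, hl, rfl⟩ | ⟨ho, hl, rfl⟩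
    · exact h ⟨hl, (Finset.mem_Icc.1 (succ_mem_of_odd ho hl)).2⟩
    · exact h ⟨(Finset.mem_Icc.1 (succ_mem_of_odd ho hl)).2, hl⟩
  by_cases ha' : a ≤ 2 * m
  · by_cases hb' : b ≤ 2 * m
    · have h := chMetric_I_horizontal hX (Finset.mem_Icc.2 ⟨(Finset.mem_Icc.1 ha).1, ha'⟩)
        (Finset.mem_Icc.2 ⟨(Finset.mem_Icc.1 hb).1, hb'⟩)
      rw [frame_of_le ha', frame_of_le hb', map_smul (proj m), map_smul (proj m), smul_comm,
        map_smul, map_smul, smul_apply, smul_eq_mul, smul_eq_mul, h]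
      ring
    · rw [proj_frame_of_lt hb hb', map_zero, h0 (by omega), zero_div]
  · rw [proj_frame_of_lt ha ha', smul_zero, map_zero, h0 (by omega), zero_div]
    rfl

theorem frameVert_eq (ha : a ∈ Finset.Icc 1 (2 * m + 2)) :
    frameVert m a b = (if a = 2 * m + 2 then 1 else 0) * (if b = 2 * m + 2 then 1 else 0)
      + (if a = 2 * m + 1 then 1 else 0) * (if b = 2 * m + 1 then 1 else 0) := by
  have h := Finset.mem_Icc.1 ha
  unfold frameVert
  grind

theorem warped_frame (hz : z ∈ punctured m) (hW : 0 < W (radial m z))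
    (hX : IsHolomorphicFrame m z X) (ha : a ∈ Finset.Icc 1 (2 * m + 2))
    (hb : b ∈ Finset.Icc 1 (2 * m + 2)) :
    warped m W z (frame m W z X a) (frame m W z X b) = if a = b then 1 else 0 := by
  have hr := radial_pos m z hz.1
  have h : (if a = b then 1 else 0 : ℝ) = frameDelta m a b + frameVert m a b := by
    unfold frameDelta frameVert
    grind
  rw [warped_apply, chMetric_frame hX ha hb, dTheta_frame hz hX ha, dTheta_frame hz hX hb,
    du_frame hz hX ha, du_frame hz hX hb, h, frameVert_eq ha]
  field_simp
  ring

open Filter Topology in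
-- Each factor `h` or `Ω` contributes `u⁻²` and each `τ` contributes `u⁻¹`. The three different
-- mixed coefficients of `riemann_warped` thereby all become `WW'/u`.
theorem riemann_frame (hz : IsRegular m W z) (hX : IsHolomorphicFrame m z X)
    (hev : ∀ b, ∀ᶠ t : ℝ in 𝓝 0, IsRegular m W (z + t • b)) {c d : ℕ}
    (ha : a ∈ Finset.Icc 1 (2 * m + 2)) (hb : b ∈ Finset.Icc 1 (2 * m + 2))
    (hc : c ∈ Finset.Icc 1 (2 * m + 2)) (hd : d ∈ Finset.Icc 1 (2 * m + 2)) :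
    riemann (warped m W) z (frame m W z X a) (frame m W z X b) (frame m W z X c)
      (frame m W z X d)
      = frameCurvature m ((1 + W (radial m z) ^ 2) / radial m z ^ 2)
        (W (radial m z) * deriv W (radial m z) / radial m z)
        (3 * (W (radial m z) * deriv W (radial m z) / radial m z)
          + (W (radial m z) * deriv (deriv W) (radial m z) + deriv W (radial m z) ^ 2)) a b c d := by
  have hr := radial_pos m z hz.1.1
  have hW := hz.2.2
  rw [riemann_warped hz _ _ _ _ hev rfl rfl rfl rfl (fun _ _ => rfl) (fun _ _ => rfl)
    (fun _ => rfl) (fun _ => rfl) (fun _ _ => rfl)]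
  simp only [chMetric_frame hX ha hc, chMetric_frame hX ha hd,
    chMetric_frame hX hb hc, chMetric_frame hX hb hd,
    chMetric_I_frame hX ha hb, chMetric_I_frame hX ha hc, chMetric_I_frame hX ha hd,
    chMetric_I_frame hX hb hc, chMetric_I_frame hX hb hd, chMetric_I_frame hX hc hd,
    dTheta_frame hz.1 hX ha, dTheta_frame hz.1 hX hb, dTheta_frame hz.1 hX hc,
    dTheta_frame hz.1 hX hd, du_frame hz.1 hX ha, du_frame hz.1 hX hb, du_frame hz.1 hX hc,
    du_frame hz.1 hX hd, frameCurvature, frameTau, frameVert_eq ha, frameVert_eq hb]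
  generalize W (radial m z) = W₀ at *
  generalize radial m z = u at *
  -- The identity is polynomial in the indicators of the vertical indices, so no case distinction is
  -- needed.
  generalize (if a = 2 * m + 1 then 1 else 0 : ℝ) = ta
  generalize (if b = 2 * m + 1 then 1 else 0 : ℝ) = tb
  generalize (if c = 2 * m + 1 then 1 else 0 : ℝ) = tc
  generalize (if d = 2 * m + 1 then 1 else 0 : ℝ) = td
  generalize (if a = 2 * m + 2 then 1 else 0 : ℝ) = ra
  generalize (if b = 2 * m + 2 then 1 else 0 : ℝ) = rb
  generalize (if c = 2 * m + 2 then 1 else 0 : ℝ) = rc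
  generalize (if d = 2 * m + 2 then 1 else 0 : ℝ) = rd
  field_simp
  ring

end Frame

/-! ### Values of the listed components. -/

section Values

variable {α β γ : ℝ} {i j : ℕ}

theorem frameCurvature_hol (hi : i ∈ Finset.Icc 1 (2 * m)) (ho : Odd i) :
    frameCurvature m α β γ i (i + 1) i (i + 1) = -4 * α := by
  have h := Finset.mem_Icc.1 (succ_mem_of_odd ho (Finset.mem_Icc.1 hi).2)
  have ho' : ¬ Odd (i + 1) := by simpa [Nat.even_add_one] using ho
  simp only [frameCurvature, frameDelta, frameOmega, frameVert, frameTau]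
  grind

theorem frameCurvature_nonhol (hi : i ∈ Finset.Icc 1 (2 * m)) (hj : j ∈ Finset.Icc 1 (2 * m))
    (hij : i ≠ j) (hp : ¬ HolPair i j) : frameCurvature m α β γ i j i j = -α := by
  rw [Finset.mem_Icc] at hi hj
  unfold HolPair at hp
  simp only [frameCurvature, frameDelta, frameOmega, frameVert, frameTau]
  grind

theorem frameCurvature_theta (hi : i ∈ Finset.Icc 1 (2 * m)) :
    frameCurvature m α β γ i (2 * m + 1) i (2 * m + 1) = -β := by
  rw [Finset.mem_Icc] at hi
  simp only [frameCurvature, frameDelta, frameOmega, frameVert, frameTau]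
  grind

theorem frameCurvature_radius (hi : i ∈ Finset.Icc 1 (2 * m)) :
    frameCurvature m α β γ i (2 * m + 2) i (2 * m + 2) = -β := by
  rw [Finset.mem_Icc] at hi
  simp only [frameCurvature, frameDelta, frameOmega, frameVert, frameTau]
  grind

theorem frameCurvature_fibre :
    frameCurvature m α β γ (2 * m + 1) (2 * m + 2) (2 * m + 1) (2 * m + 2) = -γ := by
  simp only [frameCurvature, frameDelta, frameOmega, frameVert, frameTau]
  grind

theorem frameCurvature_mixed (hi : i ∈ Finset.Icc 1 (2 * m)) (hj : j ∈ Finset.Icc 1 (2 * m))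
    (ho : Odd i) (ho' : Odd j) (hij : i ≠ j) :
    frameCurvature m α β γ i (i + 1) j (j + 1) = -2 * α ∧
    frameCurvature m α β γ i j (i + 1) (j + 1) = -α ∧
    frameCurvature m α β γ i (j + 1) (i + 1) j = α := by
  have h := Finset.mem_Icc.1 (succ_mem_of_odd ho (Finset.mem_Icc.1 hi).2)
  have h' := Finset.mem_Icc.1 (succ_mem_of_odd ho' (Finset.mem_Icc.1 hj).2)
  have hn : ¬ Odd (i + 1) := by simpa [Nat.even_add_one] using ho
  have hn' : ¬ Odd (j + 1) := by simpa [Nat.even_add_one] using ho'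
  simp only [frameCurvature, frameDelta, frameOmega, frameVert, frameTau]
  refine ⟨?_, ?_, ?_⟩ <;> grind

theorem frameCurvature_fibreMixed (hi : i ∈ Finset.Icc 1 (2 * m)) (ho : Odd i) :
    frameCurvature m α β γ i (i + 1) (2 * m + 1) (2 * m + 2) = -2 * β ∧
    frameCurvature m α β γ i (2 * m + 1) (i + 1) (2 * m + 2) = -β ∧
    frameCurvature m α β γ i (2 * m + 2) (i + 1) (2 * m + 1) = β := by
  have h := Finset.mem_Icc.1 (succ_mem_of_odd ho (Finset.mem_Icc.1 hi).2)
  have hn : ¬ Odd (i + 1) := by simpa [Nat.even_add_one] using ho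
  simp only [frameCurvature, frameDelta, frameOmega, frameVert, frameTau]
  refine ⟨?_, ?_, ?_⟩ <;> grind

end Values

end CHWarp

end

theorem theorem2p1 (m : ℕ) (I : Set ℝ) (hI : IsOpen I) (W : ℝ → ℝ)
    (hW : ContDiffOn ℝ ∞ W I) (hWpos : ∀ t ∈ I, 0 < W t)
    (q : Cvec (m + 1)) (hq : q ∈ punctured m) (hqI : radial m q ∈ I)
    (X : ℕ → Cvec (m + 1)) (hX : IsHolomorphicFrame m q X) :
    let u : ℝ := radial m q
    let W₀ : ℝ := W u
    let W₁ : ℝ := deriv W u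
    let W₂ : ℝ := deriv (deriv W) u
    let Y : ℕ → Cvec (m + 1) := frame m W q X
    let R : ℕ → ℕ → ℕ → ℕ → ℝ := fun a b c d =>
      riemann (warped m W) q (Y a) (Y b) (Y c) (Y d)
    let H : Finset ℕ := Finset.Icc 1 (2 * m)
    let A : Finset ℕ := Finset.Icc 1 (2 * m + 2)
    -- the frame is orthonormal
    (∀ a ∈ A, ∀ b ∈ A, warped m W q (Y a) (Y b) = if a = b then 1 else 0) ∧
    -- the symmetries of the curvature tensor
    (∀ a ∈ A, ∀ b ∈ A, ∀ c ∈ A, ∀ d ∈ A,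
      R b a c d = -R a b c d ∧ R a b d c = -R a b c d ∧ R c d a b = R a b c d) ∧
    -- the listed components
    (∀ i ∈ H, Odd i → R i (i + 1) i (i + 1) = -4 * ((1 + W₀ ^ 2) / u ^ 2)) ∧
    (∀ i ∈ H, ∀ j ∈ H, i ≠ j → ¬ HolPair i j → R i j i j = -((1 + W₀ ^ 2) / u ^ 2)) ∧
    (∀ i ∈ H, R i (2 * m + 1) i (2 * m + 1) = -(W₀ * W₁ / u) ∧
      R i (2 * m + 2) i (2 * m + 2) = -(W₀ * W₁ / u)) ∧
    R (2 * m + 1) (2 * m + 2) (2 * m + 1) (2 * m + 2)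
      = -3 * (W₀ * W₁ / u) - (W₀ * W₂ + W₁ ^ 2) ∧
    (∀ i ∈ H, ∀ j ∈ H, Odd i → Odd j → i ≠ j →
      R i (i + 1) j (j + 1) = -2 * ((1 + W₀ ^ 2) / u ^ 2) ∧
      2 * R i j (i + 1) (j + 1) = -2 * ((1 + W₀ ^ 2) / u ^ 2) ∧
      -2 * R i (j + 1) (i + 1) j = -2 * ((1 + W₀ ^ 2) / u ^ 2)) ∧
    (∀ i ∈ H, Odd i →
      R i (i + 1) (2 * m + 1) (2 * m + 2) = -2 * (W₀ * W₁ / u) ∧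
      2 * R i (2 * m + 1) (i + 1) (2 * m + 2) = -2 * (W₀ * W₁ / u) ∧
      -2 * R i (2 * m + 2) (i + 1) (2 * m + 1) = -2 * (W₀ * W₁ / u)) ∧
    -- all other components vanish
    (∀ a ∈ A, ∀ b ∈ A, ∀ c ∈ A, ∀ d ∈ A, ¬ Listed m a b c d → R a b c d = 0) := by
  intro u W₀ W₁ W₂ Y R H A
  have hev := eventually_isRegular_line hI hW hWpos hq hqI
  have hz : IsRegular m W q :=
    ⟨hq, hW.contDiffAt (hI.mem_nhds hqI), hWpos _ hqI⟩
  -- With this identification all the geometry is done; what remains concerns `frameCurvature`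
  -- alone.
  have hR : ∀ a ∈ A, ∀ b ∈ A, ∀ c ∈ A, ∀ d ∈ A, R a b c d = frameCurvature m
      ((1 + W₀ ^ 2) / u ^ 2) (W₀ * W₁ / u) (3 * (W₀ * W₁ / u) + (W₀ * W₂ + W₁ ^ 2)) a b c d :=
    fun a ha b hb c hc d hd => riemann_frame hz hX hev ha hb hc hd
  have hH : ∀ i ∈ H, i ∈ A := fun i hi => by
    simp only [H, A, Finset.mem_Icc] at *
    omega
  have hs : ∀ i ∈ H, Odd i → i + 1 ∈ A := fun i hi ho =>
    hH _ (succ_mem_of_odd ho (Finset.mem_Icc.1 hi).2)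
  have hT : 2 * m + 1 ∈ A := by simp [A]
  have hU : 2 * m + 2 ∈ A := by simp [A]
  refine ⟨fun a ha b hb => warped_frame hq hz.2.2 hX ha hb, fun a ha b hb c hc d hd => ?_,
    fun i hi ho => ?_, fun i hi j hj hij hp => ?_, fun i hi => ?_, ?_,
    fun i hi j hj ho ho' hij => ?_, fun i hi ho => ?_, fun a ha b hb c hc d hd hn => ?_⟩
  · rw [hR a ha b hb c hc d hd, hR b hb a ha c hc d hd, hR a ha b hb d hd c hc,
      hR c hc d hd a ha b hb]
    exact ⟨frameCurvature_swap_left _ _ _ _ _ _ _ _, frameCurvature_swap_right _ _ _ _ _ _ _ _,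
      frameCurvature_swap_pairs _ _ _ _ _ _ _ _⟩
  · have h1 := hH i hi
    have h2 := hs i hi ho
    rw [hR i h1 _ h2 i h1 _ h2, frameCurvature_hol hi ho]
  · have h1 := hH i hi
    have h2 := hH j hj
    rw [hR i h1 j h2 i h1 j h2, frameCurvature_nonhol hi hj hij hp]
  · have h1 := hH i hi
    rw [hR i h1 _ hT i h1 _ hT, hR i h1 _ hU i h1 _ hU, frameCurvature_theta hi,
      frameCurvature_radius hi]
    exact ⟨rfl, rfl⟩
  · rw [hR _ hT _ hU _ hT _ hU, frameCurvature_fibre]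
    ring
  · have h1 := hH i hi
    have h2 := hs i hi ho
    have h3 := hH j hj
    have h4 := hs j hj ho'
    obtain ⟨e1, e2, e3⟩ := frameCurvature_mixed (α := (1 + W₀ ^ 2) / u ^ 2) (β := W₀ * W₁ / u)
      (γ := 3 * (W₀ * W₁ / u) + (W₀ * W₂ + W₁ ^ 2)) hi hj ho ho' hij
    rw [hR i h1 _ h2 j h3 _ h4, hR i h1 j h3 _ h2 _ h4, hR i h1 _ h4 _ h2 j h3, e1, e2, e3]
    exact ⟨rfl, by ring, rfl⟩
  · have h1 := hH i hi
    have h2 := hs i hi ho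
    obtain ⟨e1, e2, e3⟩ := frameCurvature_fibreMixed (α := (1 + W₀ ^ 2) / u ^ 2)
      (β := W₀ * W₁ / u) (γ := 3 * (W₀ * W₁ / u) + (W₀ * W₂ + W₁ ^ 2)) hi ho
    rw [hR i h1 _ h2 _ hT _ hU, hR i h1 _ hT _ h2 _ hU, hR i h1 _ hU _ h2 _ hT, e1, e2, e3]
    exact ⟨rfl, by ring, rfl⟩
  · rw [hR a ha b hb c hc d hd, frameCurvature_eq_zero _ _ _ ha hb hn]
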